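/- For $A_0>0$ let $\epsilon_2(t)=A_0\,(t/\pi)^3\sin(\pi^2/t)$, and let $X_2=\{\gamma(t): t\ge -1\}\subset\mathbb{C}$, where $\gamma(t)=t+1$ for $-1\le t\le 0$, $\gamma(t)=(1+\epsilon_2(t))e^{it}$ for $0<t<\pi$, and $\gamma(t)=\pi-1-t$ for $t\ge\pi$. Equip $X_2$ with the Euclidean distance $d$ and the Hausdorff length $\Lambda$ (one-dimensional Hausdorff measure). Write $B(z,r)$ for the open balls of $X_2$ ($z\in X_2$, $r>0$), $B^c=X_2\setminus B$, $\lambda(x,y)=\Lambda(B(x,d(x,y)))$, and, for $B=B(z,r)$, $2B=B(z,2r)$ and $$B_\varepsilon=\{x\in B: d(x,B^c)\le\varepsilon\}\cup\{y\in B^c: d(y,B)\le\varepsilon\}.$$ There is $A_1>0$ such that for every $0<A_0<A_1$ the following hold. 0. $(X_2,d,\Lambda)$ is a space of homogeneous type: there is $C<\infty$ such that $0<\Lambda(B(x,2r))\le C\,\Lambda(B(x,r))<\infty$ for all $x\in X_2$, $r>0$. 1. $X_2$ fails the Hardy property, already for $\nu=2$. Here the Hardy property says that for every $1<\nu<\infty$,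 with $\nu'=\nu/(\nu-1)$, there is $C<\infty$ such that for every ball $B$, every $f\in L^\nu$ vanishing outside $B$ and every $g\in L^{\nu'}$ vanishing outside $2B\setminus B$, $$\int_B\int_{2B\setminus B}\frac{|f(y)g(x)|}{\lambda(x,y)}\,d\Lambda(x)\,d\Lambda(y)\le C\|f\|_\nu\|g\|_{\nu'};$$ this statement is false for $\nu=2$. 2. $X_2$ fails the relative layer decay property (RLD): there are no $\eta>0$, $C<\infty$ such that $\Lambda(B_\varepsilon\cap B(w,R))\le C(\varepsilon/R)^\eta\,\Lambda(B(w,R))$ for every ball $B=B(z,r)$, every ball $B(w,R)$ with $R\le 2r$ and every $\varepsilon>0$. 3. $X_2$ satisfies the layer decay property (LD) with exponent $\eta=1/2$: there is $C<\infty$ such that $\Lambda(B_\varepsilon)\le C(\varepsilon/r)^{1/2}\,\Lambda(B(z,r))$ for every ball $B=B(z,r)$ and every $0<\varepsilon\le r$. -/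

import Mathlib

open Set MeasureTheory Metric
open scoped NNReal ENNReal

noncomputable section

/-! ### Properties of metric measure spaces -/

/-- The space of homogeneous type condition: the measure is doubling, and balls have positive
and finite measure. -/
def IsHomogeneousType {X : Type*} [MetricSpace X] [MeasurableSpace X] (μ : Measure X) : Prop :=
  ∃ C : ℝ≥0, ∀ (x : X) (r : ℝ), 0 < r →
    0 < μ (ball x (2 * r)) ∧ μ (ball x (2 * r)) ≤ C * μ (ball x r) ∧ μ (ball x r) < ∞

/-- `lam μ x y` is the measure of the open ball centred at `x` of radius `dist x y`. -/
def lam {X : Type*} [MetricSpace X] [MeasurableSpace X] (μ : Measure X) (x y : X) : ℝ≥0∞ :=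
  μ (ball x (dist x y))

/-- The Hardy inequality for the couple `(ν, ν')`, `ν' = ν / (ν - 1)`, with a constant that is
uniform over all balls `B = ball z r`, where `2B = ball z (2 * r)`. -/
def HardyInequality {X : Type*} [MetricSpace X] [MeasurableSpace X] (μ : Measure X)
    (ν : ℝ) : Prop :=
  ∃ C : ℝ≥0, ∀ (z : X) (r : ℝ), 0 < r → ∀ f g : X → ℂ,
    MemLp f (ENNReal.ofReal ν) μ → Function.support f ⊆ ball z r →
    MemLp g (ENNReal.ofReal (ν / (ν - 1))) μ →
      Function.support g ⊆ ball z (2 * r) \ ball z r →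
    ∫⁻ y in ball z r, ∫⁻ x in ball z (2 * r) \ ball z r,
        ‖f y‖ₑ * ‖g x‖ₑ / lam μ x y ∂μ ∂μ
      ≤ C * eLpNorm f (ENNReal.ofReal ν) μ * eLpNorm g (ENNReal.ofReal (ν / (ν - 1))) μ

/-- The Hardy property: the Hardy inequality for every exponent `1 < ν < ∞`. -/
def HardyProperty {X : Type*} [MetricSpace X] [MeasurableSpace X] (μ : Measure X) : Prop :=
  ∀ ν : ℝ, 1 < ν → HardyInequality μ ν

/-- The union of the inner and outer layers of width `ε` of the ball `ball z r`.
The distance to the empty set is `∞`. -/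
def layer {X : Type*} [MetricSpace X] (z : X) (r ε : ℝ) : Set X :=
  {x | x ∈ ball z r ∧ infEDist x (ball z r)ᶜ ≤ ENNReal.ofReal ε} ∪
    {y | y ∈ (ball z r)ᶜ ∧ infEDist y (ball z r) ≤ ENNReal.ofReal ε}

/-- The layer decay property with exponent `η`, for widths `0 < ε ≤ r`. -/
def LayerDecayWith {X : Type*} [MetricSpace X] [MeasurableSpace X] (μ : Measure X)
    (η : ℝ) : Prop :=
  ∃ C : ℝ≥0, ∀ (z : X) (r : ℝ), 0 < r → ∀ ε : ℝ, 0 < ε → ε ≤ r →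
    μ (layer z r ε) ≤ C * ENNReal.ofReal ((ε / r) ^ η) * μ (ball z r)

/-- The relative layer decay property. -/
def RelativeLayerDecay {X : Type*} [MetricSpace X] [MeasurableSpace X] (μ : Measure X) : Prop :=
  ∃ η : ℝ, 0 < η ∧ ∃ C : ℝ≥0, ∀ (z : X) (r : ℝ), 0 < r →
    ∀ (w : X) (R : ℝ), 0 < R → R ≤ 2 * r → ∀ ε : ℝ, 0 < ε →
      μ (layer z r ε ∩ ball w R) ≤ C * ENNReal.ofReal ((ε / R) ^ η) * μ (ball w R)

/-! ### The curve -/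

/-- The curve made of the segment `[0, 1]`, the upper unit half-circle perturbed radially by `e`,
and the half-line `]-∞, -1]`. -/
def perturbedCurve (e : ℝ → ℝ) (t : ℝ) : ℂ :=
  if t ≤ 0 then ((t + 1 : ℝ) : ℂ)
  else if t < Real.pi then
    ⟨(1 + e t) * Real.cos t, (1 + e t) * Real.sin t⟩
  else ((Real.pi - 1 - t : ℝ) : ℂ)

/-- The image of the curve, for parameters `t ≥ -1`. As a type it carries the Euclidean distance
of the complex plane. -/
def perturbedSpace (e : ℝ → ℝ) : Set ℂ :=
  perturbedCurve e '' Ici (-1)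

/-- The polynomial oscillation with amplitude `A₀`. -/
def polyOsc (A₀ : ℝ) (t : ℝ) : ℝ :=
  A₀ * (t / Real.pi) ^ 3 * Real.sin (Real.pi ^ 2 / t)

/-- The space `X₂`. -/
abbrev XTwo (A₀ : ℝ) : Set ℂ := perturbedSpace (polyOsc A₀)

/-- The Hausdorff length on `X₂`. -/
def lengthXTwo (A₀ : ℝ) : Measure (XTwo A₀) := Measure.hausdorffMeasure 1

end

/-! ### Spaces parametrized by a bi-Lipschitz half-line -/

/-! The threshold 1/1000 on the amplitude makes the curve a bi-Lipschitz image of the half-line [-1,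
∞) (`isChordArcChart_chartXTwo`). A ball of radius r then has length comparable to r, so the length
is doubling, and every estimate can be made in the parameter.

Both failures come from the unit ball B centred at the origin. The arc point of parameter t has
distance 1 + ε₂(t) to the origin, so the arc crosses the unit circle at each t = π/m, and
consecutive crossings are about t² apart. Hence the layer of width R² contains a fixed proportion of
the ball of radius R about the point 1. As R → 0 this contradicts RLD
(`not_relativeLayerDecay_lengthXTwo`). For Hardy, test on the arcs inside and outside B with index
of order n. These have length about 1/n², and arcs whose indices differ by about i are at distance
O((i+1)/n²). The inner integral therefore exceeds a multiple of ∑ 1/(i+1) over i < n, while the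
norms stay comparable to the measure of the inner set. Divergence of the harmonic series concludes
(`not_hardyInequality_two_lengthXTwo`).

For LD, a layer of width ε lies, in the parameter, within O(ε) of the points where the distance to
the centre equals r (`IsChordArcChart.layer_subset`), so such points have to be counted. For a
centre on the arc, on the half-line, or on the segment at distance at least 1/2 from the origin,
their number is bounded: the squared distance has nonzero derivative except near t = π, where its
second derivative is nonzero. For a centre x ≤ 1/2 on the segment, the number with t ≥ τ is O(1/τ)
(`exists_encard_sqDistOsc_le`). In the variable u = π²/t the derivative is, up to a positive factor,
a multiple of cos u plus a constant plus terms vanishing at infinity with two derivatives. Each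
u-interval of length π/2 far out thus carries boundedly many zeros, and the remaining compact range
of t is treated by analyticity. Discarding 0 < t < τ costs length τ, and the other points cost
O(ε/τ). The choice τ = √ε balances the two and yields the exponent 1/2
(`IsChordArcChart.layerDecayWith_half`). -/

/-- A `K`-bi-Lipschitz parametrization of the space `X` by the half-line `[a, ∞)`. -/
structure IsChordArcChart {X : Type*} [MetricSpace X] (Γ : ℝ → X) (a : ℝ) (K : ℝ≥0) : Prop where
  exists_eq : ∀ x, ∃ t, a ≤ t ∧ Γ t = x
  dist_le : ∀ s t, a ≤ s → a ≤ t → dist (Γ s) (Γ t) ≤ K * |s - t|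
  abs_sub_le : ∀ s t, a ≤ s → a ≤ t → |s - t| ≤ K * dist (Γ s) (Γ t)

namespace IsChordArcChart

variable {X : Type*} [MetricSpace X] {Γ : ℝ → X} {a : ℝ} {K : ℝ≥0}

theorem pos (h : IsChordArcChart Γ a K) : 0 < K := by
  have h1 := h.abs_sub_le a (a + 1) le_rfl (by linarith)
  rw [show a - (a + 1) = -1 by ring, abs_neg, abs_one] at h1
  rcases eq_or_ne K 0 with h0 | h0
  · rw [h0] at h1; norm_num at h1
  · exact pos_iff_ne_zero.2 h0

theorem continuousOn (h : IsChordArcChart Γ a K) : ContinuousOn Γ (Ici a) :=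
  LipschitzOnWith.continuousOn (K := K) <| LipschitzOnWith.of_dist_le_mul fun s hs t ht => by
    rw [Real.dist_eq]; exact h.dist_le s t hs ht

/-- A point of the layer has a neighbour on the other side of the sphere. By the intermediate value
theorem the chart meets the sphere at a parameter between the two. The infimum distance need not be
attained, so the neighbour is taken within 2ε, whence the factor 2. -/
theorem layer_subset (h : IsChordArcChart Γ a K) (z : X) (r : ℝ) {ε : ℝ} (hε : 0 < ε) :
    layer z r ε ⊆
      Γ '' {t | a ≤ t ∧ ∃ s ∈ {s | a ≤ s ∧ dist (Γ s) z = r}, |t - s| ≤ 2 * K * ε} := by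
  have key : ∀ x y : X, edist x y < ENNReal.ofReal (2 * ε) →
      r ∈ uIcc (dist x z) (dist y z) →
      x ∈ Γ '' {t | a ≤ t ∧ ∃ s ∈ {s | a ≤ s ∧ dist (Γ s) z = r}, |t - s| ≤ 2 * K * ε} := by
    intro x y hxy hr
    obtain ⟨t, ht, rfl⟩ := h.exists_eq x
    obtain ⟨t', ht', rfl⟩ := h.exists_eq y
    have hsub : uIcc t t' ⊆ Ici a := fun s hs => le_trans (le_min ht ht') hs.1
    have hc : ContinuousOn (fun s => dist (Γ s) z) (uIcc t t') :=
      (continuous_id.dist continuous_const).comp_continuousOn (h.continuousOn.mono hsub)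
    obtain ⟨s, hs, hsr⟩ := intermediate_value_uIcc hc hr
    refine ⟨t, ⟨ht, s, ⟨hsub hs, hsr⟩, ?_⟩, rfl⟩
    have h1 : |t - s| ≤ |t - t'| := by
      have := abs_sub_left_of_mem_uIcc hs
      rw [abs_sub_comm t s, abs_sub_comm t t']; exact this
    have h2 : dist (Γ t) (Γ t') ≤ 2 * ε := by
      rw [edist_dist] at hxy
      exact ((ENNReal.ofReal_lt_ofReal_iff (by positivity)).1 hxy).le
    calc |t - s| ≤ |t - t'| := h1
      _ ≤ K * dist (Γ t) (Γ t') := h.abs_sub_le t t' ht ht'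
      _ ≤ K * (2 * ε) := by gcongr
      _ = 2 * K * ε := by ring
  have hlt : ENNReal.ofReal ε < ENNReal.ofReal (2 * ε) :=
    (ENNReal.ofReal_lt_ofReal_iff (by positivity)).2 (by linarith)
  rintro x (⟨hx, hd⟩ | ⟨hx, hd⟩)
  · obtain ⟨y, hy, hxy⟩ := infEDist_lt_iff.1 (hd.trans_lt hlt)
    rw [mem_ball] at hx
    rw [mem_compl_iff, mem_ball, not_lt] at hy
    exact key x y hxy (mem_uIcc.2 (Or.inl ⟨hx.le, hy⟩))
  · obtain ⟨y, hy, hxy⟩ := infEDist_lt_iff.1 (hd.trans_lt hlt)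
    rw [mem_ball] at hy
    rw [mem_compl_iff, mem_ball, not_lt] at hx
    exact key x y hxy (mem_uIcc.2 (Or.inr ⟨hy.le, hx⟩))

variable [MeasurableSpace X] [BorelSpace X]

theorem measure_image_le (h : IsChordArcChart Γ a K) {T : Set ℝ} (hT : T ⊆ Ici a) :
    (Measure.hausdorffMeasure 1 : Measure X) (Γ '' T) ≤ K * volume T := by
  have hl : LipschitzOnWith K Γ T := LipschitzOnWith.of_dist_le_mul fun s hs t ht => by
    rw [Real.dist_eq]; exact h.dist_le s t (hT hs) (hT ht)
  have := hl.hausdorffMeasure_image_le (d := 1) zero_le_one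
  rwa [hausdorffMeasure_real, ENNReal.rpow_one] at this

/-- The inverse of the chart is `K`-Lipschitz as well, and Hausdorff measure on the line is Lebesgue
measure. -/
theorem volume_le (h : IsChordArcChart Γ a K) {T : Set ℝ} (hT : T ⊆ Ici a) :
    volume T ≤ K * (Measure.hausdorffMeasure 1 : Measure X) (Γ '' T) := by
  choose g hg hΓ using h.exists_eq
  have hl : LipschitzWith K g := LipschitzWith.of_dist_le_mul fun x y => by
    rw [Real.dist_eq]
    simpa only [hΓ] using h.abs_sub_le (g x) (g y) (hg x) (hg y)
  have himg : g '' (Γ '' T) = T := by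
    have : ∀ t ∈ T, g (Γ t) = t := fun t ht => by
      have := h.abs_sub_le (g (Γ t)) t (hg _) (hT ht)
      rw [hΓ, dist_self, mul_zero] at this
      exact sub_eq_zero.1 (abs_nonpos_iff.1 this)
    rw [image_image]
    exact (image_congr this).trans (image_id' T)
  have := (hl.lipschitzOnWith (s := Γ '' T)).hausdorffMeasure_image_le (d := 1) zero_le_one
  rwa [himg, hausdorffMeasure_real, ENNReal.rpow_one] at this

theorem measurableSet_image (h : IsChordArcChart Γ a K) {T : Set ℝ} (hT : T ⊆ Ici a)
    (hTm : MeasurableSet T) : MeasurableSet (Γ '' T) := by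
  choose g hg hΓ using h.exists_eq
  have hl : LipschitzWith K g := LipschitzWith.of_dist_le_mul fun x y => by
    rw [Real.dist_eq]
    simpa only [hΓ] using h.abs_sub_le (g x) (g y) (hg x) (hg y)
  have : Γ '' T = g ⁻¹' T := by
    ext x
    constructor
    · rintro ⟨t, ht, rfl⟩
      have := h.abs_sub_le (g (Γ t)) t (hg _) (hT ht)
      rw [hΓ, dist_self, mul_zero] at this
      rw [mem_preimage, sub_eq_zero.1 (abs_nonpos_iff.1 this)]
      exact ht
    · intro hx
      exact ⟨g x, hx, hΓ x⟩
  rw [this]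
  exact hl.continuous.measurable hTm

theorem measure_ball_le (h : IsChordArcChart Γ a K) (x : X) (r : ℝ) :
    (Measure.hausdorffMeasure 1 : Measure X) (ball x r) ≤ ENNReal.ofReal (2 * K ^ 2 * r) := by
  obtain ⟨s, hs, rfl⟩ := h.exists_eq x
  have hsub : ball (Γ s) r ⊆ Γ '' (Icc (s - K * r) (s + K * r) ∩ Ici a) := by
    intro y hy
    obtain ⟨t, ht, rfl⟩ := h.exists_eq y
    have h1 := (h.abs_sub_le t s ht hs).trans
      (mul_le_mul_of_nonneg_left (mem_ball.1 hy).le K.coe_nonneg)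
    rw [abs_le] at h1
    exact ⟨t, ⟨⟨by linarith, by linarith⟩, ht⟩, rfl⟩
  calc _ ≤ _ := measure_mono hsub
    _ ≤ K * volume (Icc (s - K * r) (s + K * r) ∩ Ici a) := h.measure_image_le inter_subset_right
    _ ≤ K * volume (Icc (s - K * r) (s + K * r)) := by gcongr; exact inter_subset_left
    _ = ENNReal.ofReal (2 * K ^ 2 * r) := by
      rw [Real.volume_Icc, ← ENNReal.ofReal_coe_nnreal, ← ENNReal.ofReal_mul K.coe_nonneg]
      congr 1; ring

theorem ofReal_le_measure_ball (h : IsChordArcChart Γ a K) (x : X) {r : ℝ} :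
    ENNReal.ofReal r ≤ K ^ 2 * (Measure.hausdorffMeasure 1 : Measure X) (ball x r) := by
  obtain ⟨s, hs, rfl⟩ := h.exists_eq x
  have hK := h.pos
  have hK' : (0 : ℝ) < K := hK
  have hT : Ioo s (s + r / K) ⊆ Ici a := fun t ht => hs.trans ht.1.le
  have hsub : Γ '' Ioo s (s + r / K) ⊆ ball (Γ s) r := by
    rintro _ ⟨t, ht, rfl⟩
    rw [mem_ball]
    refine (h.dist_le t s (hT ht) hs).trans_lt ?_
    rw [abs_of_pos (by linarith [ht.1])]
    have : t - s < r / K := by linarith [ht.2]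
    calc (K : ℝ) * (t - s) < K * (r / K) := by gcongr
      _ = r := by field_simp
  have h1 := h.volume_le hT
  rw [Real.volume_Ioo, show s + r / K - s = r / K by ring] at h1
  calc ENNReal.ofReal r = K * ENNReal.ofReal (r / K) := by
        rw [← ENNReal.ofReal_coe_nnreal, ← ENNReal.ofReal_mul K.coe_nonneg]
        congr 1; field_simp
    _ ≤ K * (K * (Measure.hausdorffMeasure 1 : Measure X) (ball (Γ s) r)) := by
        gcongr
        exact h1.trans (by gcongr)
    _ = _ := by ring

theorem isHomogeneousType (h : IsChordArcChart Γ a K) :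
    IsHomogeneousType (Measure.hausdorffMeasure 1 : Measure X) := by
  refine ⟨4 * K ^ 2 * K ^ 2, fun x r hr => ⟨?_, ?_, ?_⟩⟩
  · have h1 := h.ofReal_le_measure_ball x (r := 2 * r)
    have h2 : 0 < ENNReal.ofReal (2 * r) := ENNReal.ofReal_pos.2 (by positivity)
    by_contra h0
    rw [nonpos_iff_eq_zero.1 (not_lt.1 h0), mul_zero] at h1
    exact absurd h2 (not_lt.2 h1)
  · calc _ ≤ ENNReal.ofReal (2 * K ^ 2 * (2 * r)) := h.measure_ball_le x (2 * r)
      _ = ((4 * K ^ 2 : ℝ≥0) : ℝ≥0∞) * ENNReal.ofReal r := by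
        rw [← ENNReal.ofReal_coe_nnreal, ← ENNReal.ofReal_mul (NNReal.coe_nonneg _)]
        congr 1; push_cast; ring
      _ ≤ ((4 * K ^ 2 : ℝ≥0) : ℝ≥0∞) *
          (K ^ 2 * (Measure.hausdorffMeasure 1 : Measure X) (ball x r)) := by
        gcongr; exact h.ofReal_le_measure_ball x
      _ = _ := by push_cast; ring
  · exact (h.measure_ball_le x r).trans_lt ENNReal.ofReal_lt_top

end IsChordArcChart

theorem volume_neighborhood_le {S : Set ℝ} {n : ℕ} (hS : S.encard ≤ n) (δ : ℝ) :
    volume {t | ∃ s ∈ S, |t - s| ≤ δ} ≤ ENNReal.ofReal (n * (2 * δ)) := by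
  have hfin : S.Finite := finite_of_encard_le_coe hS
  have hsub : {t | ∃ s ∈ S, |t - s| ≤ δ} ⊆ ⋃ s ∈ hfin.toFinset, Icc (s - δ) (s + δ) := by
    rintro t ⟨s, hs, ht⟩
    rw [abs_le] at ht
    simp only [mem_iUnion]
    exact ⟨s, hfin.mem_toFinset.2 hs, by linarith, by linarith⟩
  refine (measure_mono hsub).trans ((measure_biUnion_finset_le _ _).trans ?_)
  have hcard : hfin.toFinset.card ≤ n := by
    rw [hfin.encard_eq_coe_toFinset_card] at hS
    exact_mod_cast hS
  calc ∑ s ∈ hfin.toFinset, volume (Icc (s - δ) (s + δ))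
      = ∑ s ∈ hfin.toFinset, ENNReal.ofReal (2 * δ) := by
        refine Finset.sum_congr rfl fun s _ => ?_
        rw [Real.volume_Icc]; congr 1; ring
    _ = hfin.toFinset.card * ENNReal.ofReal (2 * δ) := by
        rw [Finset.sum_const, nsmul_eq_mul]
    _ ≤ n * ENNReal.ofReal (2 * δ) := by gcongr
    _ = _ := by
        rw [ENNReal.ofReal_mul (Nat.cast_nonneg n), ENNReal.ofReal_natCast]

/-- In the first alternative the layer has length O(ε), better than required. In the second, the
crossings may accumulate at 0 from the right but only O(1/τ) of them lie outside `Ioo 0 τ`. With τ =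
√ε the discarded interval and the neighbourhoods of the others both have length O(√ε). -/
theorem IsChordArcChart.layerDecayWith_half {X : Type*} [MetricSpace X] [MeasurableSpace X]
    [BorelSpace X] {Γ : ℝ → X} {a : ℝ} {K : ℝ≥0} (h : IsChordArcChart Γ a K) (N : ℕ)
    (hS : ∀ z r, 0 < r → {s | a ≤ s ∧ dist (Γ s) z = r}.encard ≤ N ∨
      (1 / 4 ≤ r ∧ r ≤ 3 ∧ ∀ τ, 0 < τ → τ ≤ 2 → ∃ n : ℕ,
        ({s | a ≤ s ∧ dist (Γ s) z = r} \ Ioo 0 τ).encard ≤ n ∧ n * τ ≤ N)) :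
    LayerDecayWith (Measure.hausdorffMeasure 1 : Measure X) (1 / 2) := by
  have hK' : (0 : ℝ) ≤ K := K.coe_nonneg
  -- In the second case the 1 pays for the discarded interval, 4KN for the remaining crossings, 8K
  -- for the two margins of width 2Kε. The outer 2 comes from √ε ≤ 2√(ε/r)·r, valid for r ≥ 1/4.
  set D : ℝ≥0 := 2 * (1 + 4 * K * (N + 2)) with hD
  have hDr : (D : ℝ) = 2 * (1 + 4 * K * (N + 2)) := by rw [hD]; push_cast; ring
  have hD4 : 4 * (K : ℝ) * N ≤ D := by
    rw [hDr]; have : (0 : ℝ) ≤ K * N := by positivity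
    nlinarith
  refine ⟨K * D * K ^ 2, fun z r hr ε hε hεr => ?_⟩
  set S := {s | a ≤ s ∧ dist (Γ s) z = r} with hSdef
  have hmain : volume {t | ∃ s ∈ S, |t - s| ≤ 2 * K * ε} ≤
      ENNReal.ofReal (D * (√(ε / r) * r)) := by
    have hq : ε / r ≤ √(ε / r) := by
      have h1 : ε / r ≤ 1 := (div_le_one hr).2 hεr
      have h0 : 0 ≤ ε / r := by positivity
      exact Real.le_sqrt_of_sq_le (by nlinarith)
    have hεle : ε ≤ √(ε / r) * r := by
      calc ε = ε / r * r := by field_simp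
        _ ≤ _ := by gcongr
    rcases hS z r hr with hN | ⟨hr4, hr3, hτ⟩
    · refine (volume_neighborhood_le hN _).trans (ENNReal.ofReal_le_ofReal ?_)
      calc (N : ℝ) * (2 * (2 * K * ε)) = 4 * K * N * ε := by ring
        _ ≤ D * (√(ε / r) * r) := by gcongr
    · have hsq : √ε * √ε = ε := Real.mul_self_sqrt hε.le
      have hs0 : 0 < √ε := Real.sqrt_pos.2 hε
      -- This uses ε ≤ r ≤ 3.
      have hs2 : √ε ≤ 2 := by nlinarith
      obtain ⟨n, hn, hnN⟩ := hτ √ε hs0 hs2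
      have hsub : {t | ∃ s ∈ S, |t - s| ≤ 2 * K * ε} ⊆
          {t | ∃ s ∈ S \ Ioo 0 √ε, |t - s| ≤ 2 * K * ε} ∪
            Icc (-(2 * K * ε)) (√ε + 2 * K * ε) := by
        rintro t ⟨s, hs, hts⟩
        by_cases hst : s ∈ Ioo 0 √ε
        · rw [abs_le] at hts
          exact Or.inr ⟨by linarith [hst.1], by linarith [hst.2]⟩
        · exact Or.inl ⟨s, ⟨hs, hst⟩, hts⟩
      refine (measure_mono hsub).trans ((measure_union_le _ _).trans ?_)
      refine (add_le_add (volume_neighborhood_le hn _) le_rfl).trans ?_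
      rw [Real.volume_Icc, ← ENNReal.ofReal_add (by positivity) (by linarith [mul_nonneg hK' hε.le])]
      refine ENNReal.ofReal_le_ofReal ?_
      have hτr : √ε ≤ 2 * (√(ε / r) * r) := by
        have hrr : √r * √r = r := Real.mul_self_sqrt hr.le
        have hr12 : 1 / 2 ≤ √r := Real.le_sqrt_of_sq_le (by linarith)
        have h1 : √r ≤ 2 * r := by nlinarith
        have h2 : √ε = √(ε / r) * √r := by
          rw [← Real.sqrt_mul (by positivity)]; congr 1; field_simp
        rw [h2]
        nlinarith [Real.sqrt_nonneg (ε / r)]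
      have hnε : n * ε ≤ N * √ε := by
        calc n * ε = n * √ε * √ε := by rw [mul_assoc, hsq]
          _ ≤ N * √ε := by gcongr
      have hε2 : ε ≤ 2 * √ε := by nlinarith
      calc n * (2 * (2 * K * ε)) + (√ε + 2 * K * ε - -(2 * K * ε))
          = 4 * K * (n * ε) + √ε + 4 * K * ε := by ring
        _ ≤ 4 * K * (N * √ε) + √ε + 4 * K * (2 * √ε) := by gcongr
        _ = (1 + 4 * K * (N + 2)) * √ε := by ring
        _ ≤ (1 + 4 * K * (N + 2)) * (2 * (√(ε / r) * r)) := by gcongr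
        _ = _ := by rw [hDr]; ring
  rw [← Real.sqrt_eq_rpow]
  calc _ ≤ _ := measure_mono (h.layer_subset z r hε)
    _ ≤ K * volume {t | a ≤ t ∧ ∃ s ∈ S, |t - s| ≤ 2 * K * ε} :=
      h.measure_image_le fun t ht => ht.1
    _ ≤ K * volume {t | ∃ s ∈ S, |t - s| ≤ 2 * K * ε} := by
      gcongr; exact And.right
    _ ≤ K * ENNReal.ofReal (D * (√(ε / r) * r)) := by gcongr
    _ = K * (D * (ENNReal.ofReal √(ε / r) * ENNReal.ofReal r)) := by
      rw [ENNReal.ofReal_mul D.coe_nonneg, ENNReal.ofReal_mul (Real.sqrt_nonneg _),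
        ENNReal.ofReal_coe_nnreal]
    _ ≤ K * (D * (ENNReal.ofReal √(ε / r) *
        (K ^ 2 * (Measure.hausdorffMeasure 1 : Measure X) (ball z r)))) := by
      gcongr; exact h.ofReal_le_measure_ball z
    _ = _ := by push_cast; ring

/-! ### Counting zeros -/

/-- Counting the elements of `Z` to the left of a point is strictly increasing on `S`, with values
in {0, …, n}. -/
theorem encard_le_of_separated {S Z : Set ℝ} {n : ℕ} (hZ : Z.encard ≤ n)
    (h : ∀ a ∈ S, ∀ b ∈ S, a < b → ∃ z ∈ Z, a < z ∧ z < b) : S.encard ≤ n + 1 := by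
  have hfin : Z.Finite := finite_of_encard_le_coe hZ
  have hmaps : MapsTo (fun s => (Z ∩ Iio s).ncard) S (Finset.range (n + 1) : Set ℕ) := by
    intro s _
    have h1 : (Z ∩ Iio s).ncard ≤ Z.ncard := ncard_le_ncard inter_subset_left hfin
    have h2 : Z.ncard ≤ n := by
      rw [← hfin.cast_ncard_eq] at hZ
      exact_mod_cast hZ
    simp only [Finset.coe_range, mem_Iio]
    omega
  have hlt : ∀ a ∈ S, ∀ b ∈ S, a < b → (Z ∩ Iio a).ncard < (Z ∩ Iio b).ncard := by
    intro a ha b hb hab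
    obtain ⟨z, hz, haz, hzb⟩ := h a ha b hb hab
    refine ncard_lt_ncard ⟨fun y hy => ⟨hy.1, hy.2.trans hab⟩, fun hsub => ?_⟩
      (hfin.subset inter_subset_left)
    exact absurd (hsub ⟨hz, hzb⟩).2 (not_lt.2 haz.le)
  have hinj : InjOn (fun s => (Z ∩ Iio s).ncard) S := by
    intro a ha b hb hab
    rcases lt_trichotomy a b with h1 | h1 | h1
    · exact absurd hab (hlt a ha b hb h1).ne
    · exact h1
    · exact absurd hab (hlt b hb a ha h1).ne'
  refine (encard_le_encard_of_injOn hmaps hinj).trans ?_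
  rw [encard_coe_eq_coe_finsetCard, Finset.card_range]
  norm_cast

/-- Rolle's theorem: two zeros of f are separated by an interior zero of f'. -/
theorem encard_zeros_le_succ {I : Set ℝ} (hI : I.OrdConnected) {f f' : ℝ → ℝ}
    (hc : ContinuousOn f I) (hd : ∀ t ∈ interior I, HasDerivAt f (f' t) t) {n : ℕ}
    (hn : {t ∈ interior I | f' t = 0}.encard ≤ n) : {t ∈ I | f t = 0}.encard ≤ n + 1 := by
  refine encard_le_of_separated hn fun a ha b hb hab => ?_
  have hsub : Icc a b ⊆ I := hI.out ha.1 hb.1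
  have hsub' : Ioo a b ⊆ interior I := interior_maximal (Ioo_subset_Icc_self.trans hsub) isOpen_Ioo
  obtain ⟨c, hc, hc0⟩ := exists_hasDerivAt_eq_zero hab (hc.mono hsub) (ha.2.trans hb.2.symm)
    fun t ht => hd t (hsub' ht)
  exact ⟨c, ⟨hsub' hc, hc0⟩, hc.1, hc.2⟩

theorem encard_zeros_le_one {I : Set ℝ} (hI : I.OrdConnected) {f f' : ℝ → ℝ}
    (hc : ContinuousOn f I) (hd : ∀ t ∈ interior I, HasDerivAt f (f' t) t)
    (hne : ∀ t ∈ interior I, f' t ≠ 0) : {t ∈ I | f t = 0}.encard ≤ 1 := by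
  have h0 : {t ∈ interior I | f' t = 0} = ∅ := by
    ext t; simpa using hne t
  simpa using encard_zeros_le_succ hI hc hd (n := 0) (by rw [h0]; simp)

theorem encard_zeros_le_two {I : Set ℝ} (hI : I.OrdConnected) {f f' f'' : ℝ → ℝ}
    (hc : ContinuousOn f I) (hd : ∀ t ∈ interior I, HasDerivAt f (f' t) t)
    (hd' : ∀ t ∈ interior I, HasDerivAt f' (f'' t) t)
    (hne : ∀ t ∈ interior I, f'' t ≠ 0) : {t ∈ I | f t = 0}.encard ≤ 2 := by
  have h1 := encard_zeros_le_one (I := interior I) hI.interior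
    (fun t ht => (hd' t ht).continuousAt.continuousWithinAt)
    (by rwa [interior_interior]) (by rwa [interior_interior])
  simpa [one_add_one_eq_two] using encard_zeros_le_succ hI hc hd (n := 1) (by simpa using h1)

theorem encard_le_of_subset_union {S S₁ S₂ : Set ℝ} {m n : ℕ} (h₁ : S₁.encard ≤ m)
    (h₂ : S₂.encard ≤ n) (h : S ⊆ S₁ ∪ S₂) : S.encard ≤ (m + n : ℕ) := by
  refine (encard_le_encard h).trans ((encard_union_le _ _).trans ?_)
  push_cast
  exact add_le_add h₁ h₂

theorem encard_biUnion_lt_le {S : ℕ → Set ℝ} {m : ℕ} (h : ∀ k, (S k).encard ≤ m) (n : ℕ) :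
    (⋃ k < n, S k).encard ≤ (n * m : ℕ) := by
  induction n with
  | zero => simp
  | succ n ih =>
    rw [add_mul, one_mul]
    refine encard_le_of_subset_union ih (h n) fun t ht => ?_
    simp only [mem_iUnion, exists_prop] at ht
    obtain ⟨k, hk, htk⟩ := ht
    rcases Nat.lt_succ_iff_lt_or_eq.1 hk with h1 | rfl
    · exact Or.inl (by simp only [mem_iUnion, exists_prop]; exact ⟨k, h1, htk⟩)
    · exact Or.inr htk

/-- Infinitely many zeros would accumulate in the compact set, and the identity theorem would force
f = 0 on U. -/
theorem AnalyticOnNhd.finite_zeros {f : ℝ → ℝ} {U K : Set ℝ} (hf : AnalyticOnNhd ℝ f U)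
    (hU : IsPreconnected U) {x₀ : ℝ} (hx₀ : x₀ ∈ U) (hne : f x₀ ≠ 0) (hK : IsCompact K)
    (hKU : K ⊆ U) : {t ∈ K | f t = 0}.Finite := by
  by_contra hinf
  obtain ⟨x, hxK, hx⟩ :=
    Set.Infinite.exists_accPt_of_subset_isCompact (s := {t ∈ K | f t = 0}) hinf hK (sep_subset _ _)
  refine hne (hf.eqOn_zero_of_preconnected_of_frequently_eq_zero hU (hKU hxK) ?_ hx₀)
  exact (accPt_iff_frequently_nhdsNE.1 hx).mono fun t ht => ht.2

/-- The zeros of the members of a pencil `P - x Q` of analytic functions on a compact interval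
are bounded in number, uniformly in `x`. -/
theorem AnalyticOnNhd.exists_encard_pencil_le {P Q : ℝ → ℝ} {U : Set ℝ}
    (hP : AnalyticOnNhd ℝ P U) (hQ : AnalyticOnNhd ℝ Q U) (hU : IsPreconnected U)
    (hUo : IsOpen U) {t₁ t₂ : ℝ} (ht₁ : t₁ ∈ U) (ht₂ : t₂ ∈ U) (hQ₁ : Q t₁ ≠ 0)
    (hne : P t₂ ≠ P t₁ / Q t₁ * Q t₂) {a b : ℝ} (hab : Icc a b ⊆ U) :
    ∃ N : ℕ, ∀ x, {t ∈ Icc a b | P t - x * Q t = 0}.encard ≤ N := by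
  -- `W` is the Wronskian, the numerator of the derivative of P/Q. The zeros of P - xQ where Q ≠ 0
  -- are the solutions of P/Q = x, so Rolle's theorem separates them by zeros of `W`, a set
  -- independent of x.
  set W : ℝ → ℝ := fun t => deriv P t * Q t - P t * deriv Q t with hW
  have hWa : AnalyticOnNhd ℝ W U := (hP.deriv.mul hQ).sub (hP.mul hQ.deriv)
  have hquot : ∀ t ∈ U, Q t ≠ 0 → HasDerivAt (fun t => P t / Q t) (W t / Q t ^ 2) t :=
    fun t ht h0 => (hP t ht).differentiableAt.hasDerivAt.div
      (hQ t ht).differentiableAt.hasDerivAt h0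
  obtain ⟨t₀, ht₀, hQW⟩ : ∃ t₀ ∈ U, Q t₀ * W t₀ ≠ 0 := by
    -- If QW vanished identically, P/Q would be constant near t₁. By analyticity P would be
    -- proportional to Q on all of U, contrary to the hypothesis at t₂.
    by_contra! hall
    have hev : ∀ᶠ t in nhds t₁, t ∈ U ∧ Q t ≠ 0 :=
      (hUo.eventually_mem ht₁).and ((hQ t₁ ht₁).continuousAt.eventually_ne hQ₁)
    obtain ⟨δ, hδ, hball⟩ := Metric.eventually_nhds_iff_ball.1 hev
    have hconst : ∀ t ∈ ball t₁ δ, P t / Q t = P t₁ / Q t₁ := fun t ht =>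
      isOpen_ball.is_const_of_deriv_eq_zero (convex_ball t₁ δ).isPreconnected
        (fun s hs => (hquot s (hball s hs).1 (hball s hs).2).differentiableAt.differentiableWithinAt)
        (fun s hs => by
          rw [(hquot s (hball s hs).1 (hball s hs).2).deriv]
          have := (mul_eq_zero.1 (hall s (hball s hs).1)).resolve_left (hball s hs).2
          simp [this]) ht (mem_ball_self hδ)
    have hz : (fun t => P t - P t₁ / Q t₁ * Q t) =ᶠ[nhds t₁] 0 := by
      filter_upwards [ball_mem_nhds t₁ hδ] with t ht
      have h1 := hconst t ht
      rw [div_eq_iff (hball t ht).2] at h1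
      simp only [Pi.zero_apply]
      rw [← h1, sub_self]
    have han : AnalyticOnNhd ℝ (fun t => P t - P t₁ / Q t₁ * Q t) U :=
      hP.sub (analyticOnNhd_const.mul hQ)
    exact hne (sub_eq_zero.1 (han.eqOn_zero_of_preconnected_of_eventuallyEq_zero hU ht₁ hz ht₂))
  have hfin : {t ∈ Icc a b | Q t * W t = 0}.Finite :=
    AnalyticOnNhd.finite_zeros (f := fun t => Q t * W t) (hQ.mul hWa) hU ht₀ hQW isCompact_Icc hab
  set Z := {t ∈ Icc a b | Q t * W t = 0} with hZ
  have hZn : Z.encard ≤ Z.ncard := by rw [hfin.cast_ncard_eq]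
  -- The first term allows for the zeros lying in `Z`; the second bounds those outside, any two of
  -- which have a point of `Z` between them.
  refine ⟨Z.ncard + (Z.ncard + 1), fun x => ?_⟩
  refine encard_le_of_subset_union (S₂ := {t ∈ Icc a b | P t - x * Q t = 0} \ Z) hZn ?_
    (fun t ht => or_iff_not_imp_left.2 fun h => ⟨ht, h⟩)
  push_cast
  refine encard_le_of_separated hZn fun s hs t ht hst => ?_
  by_contra! hno
  have hsub : Icc s t ⊆ Icc a b := Icc_subset_Icc hs.1.1.1 ht.1.1.2
  have hnz : ∀ c ∈ Icc s t, Q c * W c ≠ 0 := by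
    intro c hc h0
    have hcZ : c ∈ Z := ⟨hsub hc, h0⟩
    rcases hc.1.eq_or_lt with h1 | h1
    · exact hs.2 (h1 ▸ hcZ)
    · have h2 := hno c hcZ h1
      exact ht.2 ((le_antisymm hc.2 h2) ▸ hcZ)
  have hd : ∀ c ∈ Icc s t, HasDerivAt (fun t => P t / Q t) (W c / Q c ^ 2) c := fun c hc =>
    hquot c (hab (hsub hc)) (left_ne_zero_of_mul (hnz c hc))
  have hval : ∀ c ∈ Icc s t, P c - x * Q c = 0 → P c / Q c = x := fun c hc h0 =>
    (div_eq_iff (left_ne_zero_of_mul (hnz c hc))).2 (sub_eq_zero.1 h0)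
  obtain ⟨c, hc, hc0⟩ := exists_hasDerivAt_eq_zero hst
    (fun c hc => (hd c hc).continuousAt.continuousWithinAt)
    ((hval s (left_mem_Icc.2 hst.le) hs.1.2).trans (hval t (right_mem_Icc.2 hst.le) ht.1.2).symm)
    fun c hc => hd c (Ioo_subset_Icc_self hc)
  have hc' := Ioo_subset_Icc_self hc
  rcases div_eq_zero_iff.1 hc0 with h1 | h1
  · exact right_ne_zero_of_mul (hnz c hc') h1
  · exact left_ne_zero_of_mul (hnz c hc') (pow_eq_zero_iff two_ne_zero |>.1 h1)

/-! ### Perturbations controlled at infinity with two derivatives -/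

open Filter Asymptotics in
/-- The function and its first two derivatives are bounded near infinity. -/
def BddCTwo (F : ℝ → ℝ) : Prop :=
  ∃ F₁ F₂ : ℝ → ℝ, (∀ᶠ u in atTop, HasDerivAt F (F₁ u) u ∧ HasDerivAt F₁ (F₂ u) u) ∧
    F =O[atTop] (fun _ => (1 : ℝ)) ∧ F₁ =O[atTop] (fun _ => (1 : ℝ)) ∧
    F₂ =O[atTop] (fun _ => (1 : ℝ))

open Filter Asymptotics in
/-- The function and its first two derivatives tend to zero at infinity. -/
def NullCTwo (F : ℝ → ℝ) : Prop :=
  ∃ F₁ F₂ : ℝ → ℝ, (∀ᶠ u in atTop, HasDerivAt F (F₁ u) u ∧ HasDerivAt F₁ (F₂ u) u) ∧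
    F =o[atTop] (fun _ => (1 : ℝ)) ∧ F₁ =o[atTop] (fun _ => (1 : ℝ)) ∧
    F₂ =o[atTop] (fun _ => (1 : ℝ))

section CTwo

open Filter Asymptotics

theorem NullCTwo.bddCTwo {F : ℝ → ℝ} (h : NullCTwo F) : BddCTwo F := by
  obtain ⟨F₁, F₂, hd, h0, h1, h2⟩ := h
  exact ⟨F₁, F₂, hd, h0.isBigO, h1.isBigO, h2.isBigO⟩

theorem NullCTwo.add {F G : ℝ → ℝ} (hF : NullCTwo F) (hG : NullCTwo G) :
    NullCTwo (fun u => F u + G u) := by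
  obtain ⟨F₁, F₂, hd, h0, h1, h2⟩ := hF
  obtain ⟨G₁, G₂, gd, g0, g1, g2⟩ := hG
  refine ⟨fun u => F₁ u + G₁ u, fun u => F₂ u + G₂ u, ?_, h0.add g0, h1.add g1, h2.add g2⟩
  filter_upwards [hd, gd] with u hu gu
  exact ⟨hu.1.add gu.1, hu.2.add gu.2⟩

theorem BddCTwo.add {F G : ℝ → ℝ} (hF : BddCTwo F) (hG : BddCTwo G) :
    BddCTwo (fun u => F u + G u) := by
  obtain ⟨F₁, F₂, hd, h0, h1, h2⟩ := hF
  obtain ⟨G₁, G₂, gd, g0, g1, g2⟩ := hG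
  refine ⟨fun u => F₁ u + G₁ u, fun u => F₂ u + G₂ u, ?_, h0.add g0, h1.add g1, h2.add g2⟩
  filter_upwards [hd, gd] with u hu gu
  exact ⟨hu.1.add gu.1, hu.2.add gu.2⟩

/-- The product rule distributes the derivatives, and each resulting term keeps one null factor.
Remainders built from products with bounded oscillating factors therefore stay null. -/
theorem NullCTwo.mul {F G : ℝ → ℝ} (hF : NullCTwo F) (hG : BddCTwo G) :
    NullCTwo (fun u => F u * G u) := by
  obtain ⟨F₁, F₂, hd, h0, h1, h2⟩ := hF
  obtain ⟨G₁, G₂, gd, g0, g1, g2⟩ := hG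
  have key : ∀ {f g : ℝ → ℝ}, f =o[atTop] (fun _ => (1 : ℝ)) → g =O[atTop] (fun _ => (1 : ℝ)) →
      (fun u => f u * g u) =o[atTop] (fun _ => (1 : ℝ)) := fun hf hg => by
    simpa using hf.mul_isBigO hg
  refine ⟨fun u => F₁ u * G u + F u * G₁ u,
    fun u => F₂ u * G u + F₁ u * G₁ u + (F₁ u * G₁ u + F u * G₂ u), ?_, key h0 g0,
    (key h1 g0).add (key h0 g1),
    ((key h2 g0).add (key h1 g1)).add ((key h1 g1).add (key h0 g2))⟩
  filter_upwards [hd, gd] with u hu gu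
  exact ⟨hu.1.mul gu.1, (hu.2.mul gu.1).add (hu.1.mul gu.2)⟩

theorem bddCTwo_const (c : ℝ) : BddCTwo (fun _ => c) :=
  ⟨fun _ => 0, fun _ => 0, Eventually.of_forall fun u => ⟨hasDerivAt_const u c, hasDerivAt_const u 0⟩,
    isBigO_const_const _ one_ne_zero _, isBigO_const_const _ one_ne_zero _,
    isBigO_const_const _ one_ne_zero _⟩

theorem NullCTwo.const_mul {F : ℝ → ℝ} (hF : NullCTwo F) (c : ℝ) :
    NullCTwo (fun u => c * F u) := by
  simpa [mul_comm] using hF.mul (bddCTwo_const c)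

theorem isBigO_sin_one : Real.sin =O[atTop] (fun _ => (1 : ℝ)) :=
  IsBigO.of_bound 1 (Eventually.of_forall fun u => by simpa using Real.abs_sin_le_one u)

theorem isBigO_cos_one : Real.cos =O[atTop] (fun _ => (1 : ℝ)) :=
  IsBigO.of_bound 1 (Eventually.of_forall fun u => by simpa using Real.abs_cos_le_one u)

theorem bddCTwo_sin : BddCTwo Real.sin :=
  ⟨Real.cos, fun u => -Real.sin u,
    Eventually.of_forall fun u => ⟨Real.hasDerivAt_sin u, Real.hasDerivAt_cos u⟩,
    isBigO_sin_one, isBigO_cos_one, isBigO_sin_one.neg_left⟩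

theorem bddCTwo_cos : BddCTwo Real.cos :=
  ⟨fun u => -Real.sin u, fun u => -Real.cos u,
    Eventually.of_forall fun u => ⟨Real.hasDerivAt_cos u, (Real.hasDerivAt_sin u).neg⟩,
    isBigO_cos_one, isBigO_sin_one.neg_left, isBigO_cos_one.neg_left⟩

theorem hasDerivAt_const_div (c : ℝ) {u : ℝ} (hu : u ≠ 0) :
    HasDerivAt (fun u => c / u) (-c / u ^ 2) u := by
  have := (hasDerivAt_inv hu).const_mul c
  simpa [div_eq_mul_inv] using this

theorem tendsto_const_div_pow_atTop (c : ℝ) {n : ℕ} (hn : n ≠ 0) :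
    Tendsto (fun u : ℝ => c / u ^ n) atTop (nhds 0) :=
  tendsto_const_nhds.div_atTop (tendsto_pow_atTop hn)

theorem nullCTwo_inv : NullCTwo (fun u => 1 / u) := by
  refine ⟨fun u => -1 / u ^ 2, fun u => 2 / u ^ 3, ?_, ?_, ?_, ?_⟩
  · filter_upwards [eventually_gt_atTop 0] with u hu
    refine ⟨hasDerivAt_const_div 1 hu.ne', ?_⟩
    exact ((hasDerivAt_const u (-1 : ℝ)).div (hasDerivAt_pow 2 u)
      (pow_ne_zero 2 hu.ne')).congr_deriv (by field_simp; norm_num; ring)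
  · simpa using (isLittleO_one_iff ℝ).2 (tendsto_const_div_pow_atTop 1 one_ne_zero)
  · exact (isLittleO_one_iff ℝ).2 (tendsto_const_div_pow_atTop (-1) two_ne_zero)
  · exact (isLittleO_one_iff ℝ).2 (tendsto_const_div_pow_atTop 2 three_ne_zero)

theorem tendsto_const_div (c : ℝ) : Tendsto (fun u : ℝ => c / u) atTop (nhds 0) := by
  simpa using tendsto_const_div_pow_atTop c one_ne_zero

theorem tendsto_sin_const_div (c : ℝ) :
    Tendsto (fun u : ℝ => Real.sin (c / u)) atTop (nhds 0) := by
  simpa [Function.comp_def] using (Real.continuous_sin.tendsto 0).comp (tendsto_const_div c)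

theorem tendsto_cos_const_div (c : ℝ) :
    Tendsto (fun u : ℝ => Real.cos (c / u)) atTop (nhds 1) := by
  simpa [Function.comp_def] using (Real.continuous_cos.tendsto 0).comp (tendsto_const_div c)

theorem nullCTwo_cos_const_div (c : ℝ) : NullCTwo (fun u => Real.cos (c / u) - 1) := by
  refine ⟨fun u => Real.sin (c / u) * (c / u ^ 2),
    fun u => Real.cos (c / u) * (-c / u ^ 2) * (c / u ^ 2) + Real.sin (c / u) * (-2 * c / u ^ 3),
    ?_, ?_, ?_, ?_⟩
  · filter_upwards [eventually_gt_atTop 0] with u hu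
    constructor
    · exact ((hasDerivAt_const_div c hu.ne').cos.sub_const 1).congr_deriv (by ring)
    · have h2 : HasDerivAt (fun u : ℝ => c / u ^ 2) (-2 * c / u ^ 3) u :=
        ((hasDerivAt_const u c).div (hasDerivAt_pow 2 u) (pow_ne_zero 2 hu.ne')).congr_deriv
          (by field_simp; norm_num; ring)
      exact ((hasDerivAt_const_div c hu.ne').sin).mul h2
  · refine (isLittleO_one_iff ℝ).2 ?_
    simpa using (tendsto_cos_const_div c).sub_const 1
  · refine (isLittleO_one_iff ℝ).2 ?_
    simpa using (tendsto_sin_const_div c).mul (tendsto_const_div_pow_atTop c two_ne_zero)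
  · refine (isLittleO_one_iff ℝ).2 ?_
    simpa using (((tendsto_cos_const_div c).mul (tendsto_const_div_pow_atTop (-c) two_ne_zero)).mul
      (tendsto_const_div_pow_atTop c two_ne_zero)).add
      ((tendsto_sin_const_div c).mul (tendsto_const_div_pow_atTop (-2 * c) three_ne_zero))

theorem nullCTwo_mul_sin_const_div {c : ℝ} (hc : c ≠ 0) :
    NullCTwo (fun u => u * Real.sin (c / u) - c) := by
  refine ⟨fun u => Real.sin (c / u) - c / u * Real.cos (c / u),
    fun u => Real.sin (c / u) * (-c ^ 2 / u ^ 3), ?_, ?_, ?_, ?_⟩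
  · filter_upwards [eventually_gt_atTop 0] with u hu
    constructor
    · exact (((hasDerivAt_id' u).mul (hasDerivAt_const_div c hu.ne').sin).sub_const c).congr_deriv
        (by field_simp; ring)
    · have h1 := hasDerivAt_const_div c hu.ne'
      exact (h1.sin.sub (h1.mul h1.cos)).congr_deriv (by field_simp; ring)
  · refine (isLittleO_one_iff ℝ).2 ?_
    -- u sin(c/u) = c sinc(c/u), and sinc is continuous with value 1 at 0.
    have h1 : Tendsto (fun u : ℝ => c * Real.sinc (c / u) - c) atTop (nhds 0) := by
      simpa using (((Real.continuous_sinc.tendsto 0).comp (tendsto_const_div c)).const_mul c).sub_const c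
    refine h1.congr' ?_
    filter_upwards [eventually_gt_atTop 0] with u hu
    rw [Real.sinc_of_ne_zero (div_ne_zero hc hu.ne')]
    field_simp
  · refine (isLittleO_one_iff ℝ).2 ?_
    simpa using (tendsto_sin_const_div c).sub
      ((tendsto_const_div c).mul (tendsto_cos_const_div c))
  · refine (isLittleO_one_iff ℝ).2 ?_
    simpa using (tendsto_sin_const_div c).mul (tendsto_const_div_pow_atTop (-c ^ 2) three_ne_zero)

/-- cos 2u keeps a constant sign on each of these intervals. -/
theorem half_le_sin_sq_or_cos_sq (k : ℕ) :
    (∀ u ∈ Icc (Real.pi / 4 + k * (Real.pi / 2)) (Real.pi / 4 + (k + 1) * (Real.pi / 2)),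
      1 / 2 ≤ Real.sin u ^ 2) ∨
    (∀ u ∈ Icc (Real.pi / 4 + k * (Real.pi / 2)) (Real.pi / 4 + (k + 1) * (Real.pi / 2)),
      1 / 2 ≤ Real.cos u ^ 2) := by
  have key : ∀ u ∈ Icc (Real.pi / 4 + k * (Real.pi / 2)) (Real.pi / 4 + (k + 1) * (Real.pi / 2)),
      (-1 : ℝ) ^ k * Real.cos (2 * u) ≤ 0 := by
    intro u hu
    have h1 := Real.cos_add_nat_mul_pi (2 * u - k * Real.pi) k
    rw [sub_add_cancel] at h1
    rw [h1, ← mul_assoc, ← mul_pow]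
    norm_num
    exact Real.cos_nonpos_of_pi_div_two_le_of_le (by linarith [hu.1]) (by linarith [hu.2])
  rcases neg_one_pow_eq_or ℝ k with h | h
  · left
    intro u hu
    have := key u hu
    rw [h, Real.cos_two_mul] at this
    nlinarith [Real.sin_sq_add_cos_sq u]
  · right
    intro u hu
    have := key u hu
    rw [h, Real.cos_two_mul] at this
    linarith

/-- The constant d disappears on differentiation, so the bound is uniform in d. Far out, ±c(1-x) sin
u or ±c(1-x) cos u dominates the perturbation in the first or second derivative, because 1 - x ≥
1/2. -/
theorem eventually_encard_cos_add_le_two {c : ℝ} (hc : 0 < c) {α β : ℝ → ℝ} (hα : NullCTwo α)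
    (hβ : NullCTwo β) : ∀ᶠ k : ℕ in atTop, ∀ x, 0 ≤ x → x ≤ 1 / 2 → ∀ d,
      {u ∈ Icc (Real.pi / 4 + k * (Real.pi / 2)) (Real.pi / 4 + (k + 1) * (Real.pi / 2)) |
        c * (1 - x) * Real.cos u + d + α u + x * β u = 0}.encard ≤ 2 := by
  obtain ⟨α₁, α₂, hdα, -, hα₁, hα₂⟩ := hα
  obtain ⟨β₁, β₂, hdβ, -, hβ₁, hβ₂⟩ := hβ
  have hc10 : 0 < c / 10 := by positivity
  have hev := ((hdα.and hdβ).and ((hα₁.bound hc10).and (hα₂.bound hc10))).and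
    ((hβ₁.bound hc10).and (hβ₂.bound hc10))
  obtain ⟨U, hU⟩ := eventually_atTop.1 hev
  have hk : Tendsto (fun k : ℕ => Real.pi / 4 + k * (Real.pi / 2)) atTop atTop :=
    tendsto_atTop_add_const_left _ _
      (tendsto_natCast_atTop_atTop.atTop_mul_const (by positivity))
  filter_upwards [hk.eventually_ge_atTop U] with k hkU x hx0 hx1 d
  set J := Icc (Real.pi / 4 + k * (Real.pi / 2)) (Real.pi / 4 + (k + 1) * (Real.pi / 2))
  have hJ : ∀ u ∈ J, U ≤ u := fun u hu => hkU.trans hu.1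
  have hd : ∀ u ∈ J, HasDerivAt (fun u => c * (1 - x) * Real.cos u + d + α u + x * β u)
      (c * (1 - x) * (-Real.sin u) + α₁ u + x * β₁ u) u := fun u hu =>
    ((((Real.hasDerivAt_cos u).const_mul (c * (1 - x))).add_const d).add
      (hU u (hJ u hu)).1.1.1.1).add ((hU u (hJ u hu)).1.1.2.1.const_mul x)
  have hd' : ∀ u ∈ J, HasDerivAt (fun u => c * (1 - x) * (-Real.sin u) + α₁ u + x * β₁ u)
      (c * (1 - x) * (-Real.cos u) + α₂ u + x * β₂ u) u := fun u hu =>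
    (((Real.hasDerivAt_sin u).neg.const_mul (c * (1 - x))).add
      (hU u (hJ u hu)).1.1.1.2).add ((hU u (hJ u hu)).1.1.2.2.const_mul x)
  -- The main term has size at least c/(2√2), the perturbation at most c/10 + c/10.
  have hne : ∀ s a b : ℝ, 1 / 2 ≤ s ^ 2 → |a| ≤ c / 10 → |b| ≤ c / 10 →
      c * (1 - x) * (-s) + a + x * b ≠ 0 := by
    intro s a b hs ha hb h0
    have h1 : c * (1 - x) * s = a + x * b := by linarith
    have h2 : |a + x * b| ≤ c / 5 := by
      calc |a + x * b| ≤ |a| + |x * b| := abs_add_le _ _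
        _ = |a| + x * |b| := by rw [abs_mul, abs_of_nonneg hx0]
        _ ≤ c / 10 + 1 * (c / 10) := by gcongr; linarith
        _ = c / 5 := by ring
    have h3 : (c * (1 - x) * s) ^ 2 ≤ (c / 5) ^ 2 := by
      rw [h1]; exact sq_le_sq' (by linarith [(abs_le.1 h2).1]) (abs_le.1 h2).2
    have h4 : (c * (1 - x) * s) ^ 2 = c ^ 2 * ((1 - x) ^ 2 * s ^ 2) := by ring
    have h5 : 1 / 4 * (1 / 2) ≤ (1 - x) ^ 2 * s ^ 2 := by
      gcongr
      nlinarith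
    have h6 : c ^ 2 * (1 / 4 * (1 / 2)) ≤ c ^ 2 * ((1 - x) ^ 2 * s ^ 2) := by gcongr
    nlinarith [pow_pos hc 2]
  have hb : ∀ {f : ℝ → ℝ} {u}, ‖f u‖ ≤ c / 10 * ‖(1 : ℝ)‖ → |f u| ≤ c / 10 := fun h => by
    simpa using h
  have hcont : ContinuousOn (fun u => c * (1 - x) * Real.cos u + d + α u + x * β u) J :=
    fun u hu => (hd u hu).continuousAt.continuousWithinAt
  -- Where sin² ≥ 1/2 the first derivative does not vanish; where cos² ≥ 1/2 the second does not.
  rcases half_le_sin_sq_or_cos_sq k with h | h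
  · refine (encard_zeros_le_one ordConnected_Icc hcont
      (fun u hu => hd u (interior_subset hu)) fun u hu => ?_).trans (by norm_num)
    have hu' := interior_subset hu
    exact hne _ _ _ (h u hu') (hb (hU u (hJ u hu')).1.2.1) (hb (hU u (hJ u hu')).2.1)
  · refine encard_zeros_le_two ordConnected_Icc hcont
      (fun u hu => hd u (interior_subset hu)) (fun u hu => hd' u (interior_subset hu))
      fun u hu => ?_
    have hu' := interior_subset hu
    exact hne _ _ _ (h u hu') (hb (hU u (hJ u hu')).1.2.2) (hb (hU u (hJ u hu')).2.2)

end CTwo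

/-! ### The radial oscillation -/

/-- The derivative of `polyOsc`. -/
noncomputable def polyOscDeriv (A t : ℝ) : ℝ :=
  A * (t / Real.pi) * (3 * t / Real.pi ^ 2 * Real.sin (Real.pi ^ 2 / t) - Real.cos (Real.pi ^ 2 / t))

/-- The second derivative of `polyOsc`. -/
noncomputable def polyOscDeriv₂ (A t : ℝ) : ℝ :=
  A * (6 * t / Real.pi ^ 3 * Real.sin (Real.pi ^ 2 / t) - 4 / Real.pi * Real.cos (Real.pi ^ 2 / t)
    - Real.pi / t * Real.sin (Real.pi ^ 2 / t))

theorem hasDerivAt_polyOsc (A : ℝ) {t : ℝ} (ht : t ≠ 0) :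
    HasDerivAt (polyOsc A) (polyOscDeriv A t) t := by
  have h1 := (((hasDerivAt_id' t).div_const Real.pi).pow 3).const_mul A
  have h2 := (hasDerivAt_const_div (Real.pi ^ 2) ht).sin
  refine (h1.mul h2).congr_deriv ?_
  have := Real.pi_ne_zero
  simp only [polyOscDeriv, Pi.pow_apply, Nat.add_one_sub_one, Nat.cast_ofNat, div_pow]
  field_simp
  ring

theorem hasDerivAt_polyOscDeriv (A : ℝ) {t : ℝ} (ht : t ≠ 0) :
    HasDerivAt (polyOscDeriv A) (polyOscDeriv₂ A t) t := by
  have h1 := ((hasDerivAt_id' t).div_const Real.pi).const_mul A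
  have h2 := hasDerivAt_const_div (Real.pi ^ 2) ht
  have h3 := (((hasDerivAt_id' t).const_mul 3).div_const (Real.pi ^ 2)).mul h2.sin
  refine (h1.mul (h3.sub h2.cos)).congr_deriv ?_
  have := Real.pi_ne_zero
  simp only [polyOscDeriv₂, Pi.mul_apply, Pi.sub_apply]
  field_simp
  ring

theorem abs_polyOsc_le {A t : ℝ} (hA : 0 ≤ A) (ht : 0 ≤ t) :
    |polyOsc A t| ≤ A * (t / Real.pi) ^ 3 := by
  have hp := Real.pi_pos
  rw [polyOsc, abs_mul, abs_of_nonneg (by positivity)]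
  exact mul_le_of_le_one_right (by positivity) (Real.abs_sin_le_one _)

theorem abs_polyOsc_le_amplitude {A t : ℝ} (hA : 0 ≤ A) (ht : 0 ≤ t) (htp : t ≤ Real.pi) :
    |polyOsc A t| ≤ A := by
  have hp := Real.pi_pos
  refine (abs_polyOsc_le hA ht).trans (mul_le_of_le_one_right hA (pow_le_one₀ (by positivity) ?_))
  rwa [div_le_one hp]

/-- The factor t is essential: near t = 0 this derivative has to be beaten by a sine that may itself
be of size t. -/
theorem abs_polyOscDeriv_le {A t : ℝ} (hA : 0 ≤ A) (ht : 0 ≤ t) (htp : t ≤ Real.pi) :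
    |polyOscDeriv A t| ≤ A * t := by
  have hp := Real.pi_pos
  have hp3 := Real.pi_gt_three
  rw [polyOscDeriv, abs_mul, abs_of_nonneg (by positivity)]
  have h1 : |3 * t / Real.pi ^ 2 * Real.sin (Real.pi ^ 2 / t) - Real.cos (Real.pi ^ 2 / t)| ≤ 2 := by
    refine (abs_sub _ _).trans ?_
    have h2 : |3 * t / Real.pi ^ 2 * Real.sin (Real.pi ^ 2 / t)| ≤ 1 := by
      rw [abs_mul, abs_of_nonneg (by positivity)]
      refine mul_le_one₀ ?_ (abs_nonneg _) (Real.abs_sin_le_one _)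
      rw [div_le_one (by positivity)]
      nlinarith
    linarith [Real.abs_cos_le_one (Real.pi ^ 2 / t)]
  calc _ ≤ A * (t / Real.pi) * 2 := by gcongr
    _ = A * t * (2 / Real.pi) := by ring
    _ ≤ A * t * 1 := by
      gcongr
      rw [div_le_one hp]; linarith
    _ = A * t := mul_one _

theorem abs_polyOscDeriv_le_four_mul {A t : ℝ} (hA : 0 ≤ A) (ht : 0 ≤ t) (htp : t ≤ Real.pi) :
    |polyOscDeriv A t| ≤ 4 * A := by
  refine (abs_polyOscDeriv_le hA ht htp).trans ?_
  nlinarith [Real.pi_lt_four]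

/-- The second derivative contains a term of order 1/t, hence the restriction to t ≥ π/2. It is
needed only near t = π. -/
theorem abs_polyOscDeriv₂_le {A t : ℝ} (hA : 0 ≤ A) (ht : Real.pi / 2 ≤ t) (htp : t ≤ Real.pi) :
    |polyOscDeriv₂ A t| ≤ 5 * A := by
  have hp := Real.pi_pos
  have hp3 := Real.pi_gt_three
  have ht0 : 0 < t := by linarith
  rw [polyOscDeriv₂, abs_mul, abs_of_nonneg hA, mul_comm]
  gcongr
  have hs := Real.abs_sin_le_one (Real.pi ^ 2 / t)
  have hc := Real.abs_cos_le_one (Real.pi ^ 2 / t)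
  have h1 : |6 * t / Real.pi ^ 3 * Real.sin (Real.pi ^ 2 / t)| ≤ 1 := by
    rw [abs_mul, abs_of_nonneg (by positivity)]
    refine mul_le_one₀ ?_ (abs_nonneg _) hs
    rw [div_le_one (by positivity)]
    have : Real.pi ^ 3 = Real.pi * Real.pi * Real.pi := by ring
    rw [this]
    have h9 : 6 ≤ Real.pi * Real.pi := by nlinarith
    nlinarith
  have h2 : |4 / Real.pi * Real.cos (Real.pi ^ 2 / t)| ≤ 2 := by
    rw [abs_mul, abs_of_nonneg (by positivity)]
    have : 4 / Real.pi ≤ 2 := by rw [div_le_iff₀ hp]; linarith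
    nlinarith [abs_nonneg (Real.cos (Real.pi ^ 2 / t))]
  have h3 : |Real.pi / t * Real.sin (Real.pi ^ 2 / t)| ≤ 2 := by
    rw [abs_mul, abs_of_nonneg (by positivity)]
    have : Real.pi / t ≤ 2 := by rw [div_le_iff₀ ht0]; linarith
    nlinarith [abs_nonneg (Real.sin (Real.pi ^ 2 / t))]
  refine (abs_sub _ _).trans ?_
  refine (add_le_add (abs_sub _ _) le_rfl).trans ?_
  linarith

theorem continuous_polyOsc (A : ℝ) : Continuous (polyOsc A) := by
  rw [continuous_iff_continuousAt]
  intro t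
  rcases eq_or_ne t 0 with rfl | ht
  · have h0 : polyOsc A 0 = 0 := by simp [polyOsc]
    rw [ContinuousAt, h0]
    have hb : Filter.Tendsto (fun t : ℝ => |A * (t / Real.pi) ^ 3|) (nhds 0) (nhds 0) := by
      have hc : Continuous (fun t : ℝ => |A * (t / Real.pi) ^ 3|) := by fun_prop
      simpa using hc.tendsto 0
    refine squeeze_zero_norm (fun t => ?_) hb
    rw [polyOsc, Real.norm_eq_abs, abs_mul]
    exact mul_le_of_le_one_right (abs_nonneg _) (Real.abs_sin_le_one _)
  · exact (hasDerivAt_polyOsc A ht).continuousAt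

theorem abs_polyOsc_sub_le {A s t : ℝ} (hA : 0 ≤ A) (hs : s ∈ Icc 0 Real.pi)
    (ht : t ∈ Icc 0 Real.pi) : |polyOsc A s - polyOsc A t| ≤ 4 * A * |s - t| := by
  wlog hst : s ≤ t generalizing s t
  · rw [abs_sub_comm, abs_sub_comm s t]; exact this ht hs (le_of_not_ge hst)
  rcases hst.eq_or_lt with rfl | hlt
  · simp
  obtain ⟨c, hc, hceq⟩ := exists_hasDerivAt_eq_slope (polyOsc A) (polyOscDeriv A) hlt
    (continuous_polyOsc A).continuousOn
    (fun x hx => hasDerivAt_polyOsc A (hs.1.trans_lt hx.1).ne')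
  have h1 : polyOsc A t - polyOsc A s = polyOscDeriv A c * (t - s) := by
    rw [hceq]; field_simp [(sub_pos.2 hlt).ne']
  rw [abs_sub_comm, h1, abs_mul, abs_sub_comm s t]
  gcongr
  exact abs_polyOscDeriv_le_four_mul hA (hs.1.trans hc.1.le) (hc.2.le.trans ht.2)

/-- The square of the distance between the points of polar coordinates `(1 + polyOsc A t, t)` and
`(y, s)`. -/
noncomputable def sqDistOsc (A y s t : ℝ) : ℝ :=
  (1 + polyOsc A t) ^ 2 - 2 * (1 + polyOsc A t) * y * Real.cos (t - s) + y ^ 2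

/-- The derivative of `sqDistOsc A y s`. -/
noncomputable def sqDistOscDeriv (A y s t : ℝ) : ℝ :=
  2 * polyOscDeriv A t * (1 + polyOsc A t - y * Real.cos (t - s)) +
    2 * y * (1 + polyOsc A t) * Real.sin (t - s)

/-- The second derivative of `sqDistOsc A y s`. -/
noncomputable def sqDistOscDeriv₂ (A y s t : ℝ) : ℝ :=
  2 * polyOscDeriv₂ A t * (1 + polyOsc A t - y * Real.cos (t - s)) +
    2 * polyOscDeriv A t * (polyOscDeriv A t + y * Real.sin (t - s)) +
    2 * y * polyOscDeriv A t * Real.sin (t - s) +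
    2 * y * (1 + polyOsc A t) * Real.cos (t - s)

theorem continuous_sqDistOsc (A y s : ℝ) : Continuous (sqDistOsc A y s) := by
  have := continuous_polyOsc A
  unfold sqDistOsc
  fun_prop

theorem hasDerivAt_sqDistOsc (A y s : ℝ) {t : ℝ} (ht : t ≠ 0) :
    HasDerivAt (sqDistOsc A y s) (sqDistOscDeriv A y s t) t := by
  have h1 := (hasDerivAt_polyOsc A ht).const_add 1
  have h2 := ((hasDerivAt_id' t).sub_const s).cos
  refine (((h1.pow 2).sub (((h1.const_mul 2).mul_const y).mul h2)).add_const (y ^ 2)).congr_deriv ?_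
  simp only [sqDistOscDeriv]
  norm_num
  ring

theorem hasDerivAt_sqDistOscDeriv (A y s : ℝ) {t : ℝ} (ht : t ≠ 0) :
    HasDerivAt (sqDistOscDeriv A y s) (sqDistOscDeriv₂ A y s t) t := by
  have h1 := (hasDerivAt_polyOsc A ht).const_add 1
  have h1' := hasDerivAt_polyOscDeriv A ht
  have h2 := ((hasDerivAt_id' t).sub_const s).cos
  have h3 := ((hasDerivAt_id' t).sub_const s).sin
  refine (((h1'.const_mul 2).mul (h1.sub (h2.const_mul y))).add
    ((h1.const_mul (2 * y)).mul h3)).congr_deriv ?_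
  simp only [sqDistOscDeriv₂, Pi.sub_apply]
  ring

/-- Jordan's inequality on the left half, carried to the right half by v ↦ π - v. The bound is
useful at both ends of the interval. -/
theorem two_div_pi_sq_mul_le_sin {v : ℝ} (h0 : 0 ≤ v) (hv : v ≤ Real.pi) :
    2 / Real.pi ^ 2 * (v * (Real.pi - v)) ≤ Real.sin v := by
  have hp := Real.pi_pos
  wlog hle : v ≤ Real.pi / 2 generalizing v
  · have := this (v := Real.pi - v) (by linarith) (by linarith) (by linarith)
    rw [Real.sin_pi_sub] at this
    calc _ = _ := by ring
      _ ≤ _ := this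
  calc 2 / Real.pi ^ 2 * (v * (Real.pi - v)) ≤ 2 / Real.pi ^ 2 * (v * Real.pi) := by
        gcongr; linarith
    _ = 2 / Real.pi * v := by field_simp
    _ ≤ Real.sin v := Real.mul_le_sin h0 hle

theorem one_fifth_mul_le_sin {v : ℝ} (h0 : 0 ≤ v) (hv : v ≤ Real.pi) :
    1 / 5 * (v * (Real.pi - v)) ≤ Real.sin v := by
  refine le_trans ?_ (two_div_pi_sq_mul_le_sin h0 hv)
  have hp := Real.pi_pos
  have : (1 : ℝ) / 5 ≤ 2 / Real.pi ^ 2 := by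
    rw [div_le_div_iff₀ (by norm_num) (by positivity)]
    nlinarith [Real.pi_lt_d2, Real.pi_gt_three]
  exact mul_le_mul_of_nonneg_right this (mul_nonneg h0 (by linarith))

/-! ### Sphere counts for centres away from the origin -/

section Counting

variable {A : ℝ}

/-- At a critical point the radial term, at most AtM, would have to balance the angular term, at
least (9/10)·y·|sin(t - s)|. -/
theorem sqDistOscDeriv_ne_zero (hA : 0 < A) (hA1 : A < 1 / 1000) {y s t M : ℝ} (hy : 0 < y)
    (ht : 0 < t) (htp : t ≤ Real.pi) (hM : |1 + polyOsc A t - y * Real.cos (t - s)| ≤ M)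
    (h : A * t * M < y * (9 / 10) * |Real.sin (t - s)|) : sqDistOscDeriv A y s t ≠ 0 := by
  intro h0
  have he := (abs_le.1 (abs_polyOsc_le_amplitude hA.le ht.le htp)).1
  have h1 : polyOscDeriv A t * (1 + polyOsc A t - y * Real.cos (t - s)) =
      -(y * (1 + polyOsc A t) * Real.sin (t - s)) := by
    rw [sqDistOscDeriv] at h0; linarith
  have h2 := congrArg abs h1
  rw [abs_mul, abs_neg, abs_mul, abs_of_pos (a := y * (1 + polyOsc A t))
    (mul_pos hy (by linarith))] at h2
  have h3 : |polyOscDeriv A t| * |1 + polyOsc A t - y * Real.cos (t - s)| ≤ A * t * M := by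
    gcongr
    exact abs_polyOscDeriv_le hA.le ht.le htp
  have h4 : y * (9 / 10) * |Real.sin (t - s)| ≤ y * (1 + polyOsc A t) * |Real.sin (t - s)| := by
    gcongr; linarith
  linarith

/-- Every term but the last carries a derivative of the oscillation, hence a factor A. Together they
are at most 49·A·y in half the second derivative, against at least 0.63·y for the cosine term. -/
theorem sqDistOscDeriv₂_ne_zero (hA : 0 < A) (hA1 : A < 1 / 1000) {y s t : ℝ} (hy : 1 / 2 ≤ y)
    (ht : Real.pi / 2 ≤ t) (htp : t ≤ Real.pi) (hcos : 7 / 10 ≤ |Real.cos (t - s)|) :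
    sqDistOscDeriv₂ A y s t ≠ 0 := by
  intro h0
  have hp := Real.pi_pos
  have ht0 : 0 ≤ t := by linarith
  have he := abs_le.1 (abs_polyOsc_le_amplitude hA.le ht0 htp)
  have h1 := abs_polyOscDeriv_le_four_mul hA.le ht0 htp
  have h2 := abs_polyOscDeriv₂_le hA.le ht htp
  have hs := Real.abs_sin_le_one (t - s)
  have hc := Real.abs_cos_le_one (t - s)
  have hy0 : 0 < y := by linarith
  have e1 : |polyOscDeriv₂ A t * (1 + polyOsc A t - y * Real.cos (t - s))| ≤
      5 * A * (5 * y) := by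
    rw [abs_mul]
    gcongr
    refine (abs_sub _ _).trans ?_
    rw [abs_mul, abs_of_pos hy0, abs_of_pos (a := 1 + polyOsc A t) (by linarith)]
    nlinarith
  have e2 : |polyOscDeriv A t * (polyOscDeriv A t + y * Real.sin (t - s))| ≤ 4 * A * (5 * y) := by
    rw [abs_mul]
    gcongr
    refine (abs_add_le _ _).trans ?_
    rw [abs_mul, abs_of_pos hy0]
    nlinarith
  have e3 : |y * polyOscDeriv A t * Real.sin (t - s)| ≤ y * (4 * A) * 1 := by
    rw [abs_mul, abs_mul, abs_of_pos hy0]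
    gcongr
  have e4 : y * (9 / 10) * (7 / 10) ≤ |y * (1 + polyOsc A t) * Real.cos (t - s)| := by
    rw [abs_mul, abs_of_pos (a := y * (1 + polyOsc A t)) (mul_pos hy0 (by linarith))]
    exact mul_le_mul (by gcongr; linarith) hcos (by norm_num) (mul_nonneg hy0.le (by linarith))
  have e5 : y * (1 + polyOsc A t) * Real.cos (t - s) =
      -(polyOscDeriv₂ A t * (1 + polyOsc A t - y * Real.cos (t - s)) +
      polyOscDeriv A t * (polyOscDeriv A t + y * Real.sin (t - s)) +
      y * polyOscDeriv A t * Real.sin (t - s)) := by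
    rw [sqDistOscDeriv₂] at h0; linarith
  rw [e5, abs_neg] at e4
  have e6 := (e4.trans (abs_add_le _ _)).trans (add_le_add (abs_add_le _ _) le_rfl)
  nlinarith

theorem encard_sqDistOsc_le_one {y s a b : ℝ} (ha : 0 ≤ a) (r : ℝ)
    (h : ∀ t ∈ Ioo a b, sqDistOscDeriv A y s t ≠ 0) :
    {t ∈ Icc a b | sqDistOsc A y s t - r ^ 2 = 0}.encard ≤ 1 := by
  refine encard_zeros_le_one ordConnected_Icc
    ((continuous_sqDistOsc A y s).sub continuous_const).continuousOn (fun t ht => ?_)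
    (fun t ht => h t ?_)
  · rw [interior_Icc] at ht
    exact (hasDerivAt_sqDistOsc A y s (ha.trans_lt ht.1).ne').sub_const _
  · rwa [interior_Icc] at ht

theorem encard_sqDistOsc_le_two {y s a b : ℝ} (ha : 0 ≤ a) (r : ℝ)
    (h : ∀ t ∈ Ioo a b, sqDistOscDeriv₂ A y s t ≠ 0) :
    {t ∈ Icc a b | sqDistOsc A y s t - r ^ 2 = 0}.encard ≤ 2 := by
  refine encard_zeros_le_two (f' := sqDistOscDeriv A y s) ordConnected_Icc
    ((continuous_sqDistOsc A y s).sub continuous_const).continuousOn (fun t ht => ?_)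
    (fun t ht => ?_) (fun t ht => h t ?_)
  · rw [interior_Icc] at ht
    exact (hasDerivAt_sqDistOsc A y s (ha.trans_lt ht.1).ne').sub_const _
  · rw [interior_Icc] at ht
    exact hasDerivAt_sqDistOscDeriv A y s (ha.trans_lt ht.1).ne'
  · rwa [interior_Icc] at ht

theorem seven_tenths_le_neg_cos {v : ℝ} (h : 3 * Real.pi / 4 ≤ v) (hv : v ≤ Real.pi) :
    7 / 10 ≤ -Real.cos v := by
  rw [← Real.cos_pi_sub]
  have h1 : Real.cos (Real.pi / 4) ≤ Real.cos (Real.pi - v) :=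
    Real.cos_le_cos_of_nonneg_of_le_pi (by linarith) (by linarith [Real.pi_pos]) (by linarith)
  rw [Real.cos_pi_div_four] at h1
  have h2 : (7 : ℝ) / 5 ≤ √2 := Real.le_sqrt_of_sq_le (by norm_num)
  linarith

theorem encard_sqDistOsc_arc_le (hA : 0 < A) (hA1 : A < 1 / 1000) {s : ℝ}
    (hs : s ∈ Icc 0 Real.pi) (r : ℝ) :
    {t ∈ Icc 0 Real.pi | sqDistOsc A (1 + polyOsc A s) s t - r ^ 2 = 0}.encard ≤ 4 := by
  have hp := Real.pi_pos
  have hp3 := Real.pi_gt_three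
  have hp4 := Real.pi_lt_d2
  have hes := abs_le.1 (abs_polyOsc_le_amplitude hA.le hs.1 hs.2)
  have hy : 9 / 10 ≤ 1 + polyOsc A s := by linarith
  -- The radial factor vanishes at t = s, which compensates the vanishing of sin(t - s) there.
  have hM : ∀ t ∈ Icc 0 Real.pi,
      |1 + polyOsc A t - (1 + polyOsc A s) * Real.cos (t - s)| ≤ 2 * |t - s| := by
    intro t ht
    have h1 := abs_polyOsc_sub_le hA.le ht hs
    have h2 : 0 ≤ 1 - Real.cos (t - s) := by linarith [Real.cos_le_one (t - s)]
    have h3 : 1 - Real.cos (t - s) ≤ |t - s| * (3.15 / 2) := by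
      have h4 := Real.one_sub_sq_div_two_le_cos (x := t - s)
      have h5 : |t - s| ≤ 3.15 := by
        rw [abs_le]; constructor <;> linarith [hs.1, hs.2, ht.1, ht.2]
      have h6 := sq_abs (t - s)
      nlinarith [abs_nonneg (t - s)]
    have h7 : 1 + polyOsc A t - (1 + polyOsc A s) * Real.cos (t - s) =
        (polyOsc A t - polyOsc A s) + (1 + polyOsc A s) * (1 - Real.cos (t - s)) := by ring
    rw [h7]
    refine (abs_add_le _ _).trans ?_
    rw [abs_of_nonneg (a := (1 + polyOsc A s) * _) (mul_nonneg (by linarith) h2)]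
    nlinarith [abs_nonneg (t - s)]
  have c1 : {t ∈ Icc 0 s | sqDistOsc A (1 + polyOsc A s) s t - r ^ 2 = 0}.encard ≤ 1 := by
    refine encard_sqDistOsc_le_one le_rfl r fun t ht => ?_
    have htp : t ≤ Real.pi := ht.2.le.trans hs.2
    refine sqDistOscDeriv_ne_zero hA hA1 (by linarith) ht.1 htp (hM t ⟨ht.1.le, htp⟩) ?_
    have hst : 0 < s - t := sub_pos.2 ht.2
    rw [abs_sub_comm t s, abs_of_pos hst, ← neg_sub s t, Real.sin_neg, abs_neg]
    have h1 := (one_fifth_mul_le_sin hst.le (by linarith [hs.2, ht.1])).trans (le_abs_self _)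
    -- Since π - (s - t) ≥ t, the sine is at least (s - t)t/5, with the same two factors as the
    -- radial bound At·2|t - s|.
    have h2 : (s - t) * t ≤ (s - t) * (Real.pi - (s - t)) := by
      gcongr; linarith [hs.2]
    have h3 : 0 < (s - t) * t := mul_pos hst ht.1
    nlinarith
  have c2 : {t ∈ Icc s (min (s + 3 * Real.pi / 4) Real.pi) |
      sqDistOsc A (1 + polyOsc A s) s t - r ^ 2 = 0}.encard ≤ 1 := by
    refine encard_sqDistOsc_le_one hs.1 r fun t ht => ?_
    have htp : t ≤ Real.pi := ht.2.le.trans (min_le_right _ _)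
    have hts : t < s + 3 * Real.pi / 4 := ht.2.trans_le (min_le_left _ _)
    have ht0 : 0 < t := hs.1.trans_lt ht.1
    refine sqDistOscDeriv_ne_zero hA hA1 (by linarith) ht0 htp (hM t ⟨ht0.le, htp⟩) ?_
    have hst : 0 < t - s := sub_pos.2 ht.1
    rw [abs_of_pos hst]
    have h1 := (one_fifth_mul_le_sin hst.le (by linarith)).trans (le_abs_self _)
    have h2 : (t - s) * (3 / 4) ≤ (t - s) * (Real.pi - (t - s)) := by
      gcongr; linarith
    have h3 : A * t ≤ 1 / 100 := by nlinarith
    nlinarith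
  -- Near the antipode of s the sine may vanish, so the second derivative is used.
  have c3 : {t ∈ Icc (s + 3 * Real.pi / 4) Real.pi |
      sqDistOsc A (1 + polyOsc A s) s t - r ^ 2 = 0}.encard ≤ 2 := by
    refine encard_sqDistOsc_le_two (by linarith [hs.1]) r fun t ht => ?_
    refine sqDistOscDeriv₂_ne_zero hA hA1 (by linarith) (by linarith [ht.1, hs.1]) ht.2.le ?_
    exact (seven_tenths_le_neg_cos (by linarith [ht.1]) (by linarith [ht.2, hs.1])).trans
      (neg_le_abs _)
  have c12 := encard_le_of_subset_union (m := 1) (n := 1) (by exact_mod_cast c1)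
    (by exact_mod_cast c2) Subset.rfl
  refine encard_le_of_subset_union (m := 2) (n := 2) c12 c3 fun t ht => ?_
  rcases le_total t s with h | h
  · exact Or.inl (Or.inl ⟨⟨ht.1.1, h⟩, ht.2⟩)
  · rcases le_total t (s + 3 * Real.pi / 4) with h' | h'
    · exact Or.inl (Or.inr ⟨⟨h, le_min h' ht.1.2⟩, ht.2⟩)
    · exact Or.inr ⟨⟨h', ht.1.2⟩, ht.2⟩

theorem encard_sqDistOsc_axis_le (hA : 0 < A) (hA1 : A < 1 / 1000) {y s : ℝ}
    (hy : 1 / 2 ≤ y) (hs : s = 0 ∨ s = Real.pi) (r : ℝ) :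
    {t ∈ Icc 0 Real.pi | sqDistOsc A y s t - r ^ 2 = 0}.encard ≤ 3 := by
  have hp := Real.pi_pos
  have hp3 := Real.pi_gt_three
  have hp4 := Real.pi_lt_d2
  have c1 : {t ∈ Icc 0 (3 * Real.pi / 4) | sqDistOsc A y s t - r ^ 2 = 0}.encard ≤ 1 := by
    refine encard_sqDistOsc_le_one le_rfl r fun t ht => ?_
    have htp : t ≤ Real.pi := by linarith [ht.2]
    have he := abs_le.1 (abs_polyOsc_le_amplitude hA.le ht.1.le htp)
    refine sqDistOscDeriv_ne_zero hA hA1 (M := 4 * y) (by linarith) ht.1 htp ?_ ?_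
    · refine (abs_sub _ _).trans ?_
      rw [abs_mul, abs_of_pos (by linarith : 0 < y),
        abs_of_pos (a := 1 + polyOsc A t) (by linarith)]
      nlinarith [Real.abs_cos_le_one (t - s)]
    · have h1 : |Real.sin (t - s)| = |Real.sin t| := by
        rcases hs with rfl | rfl
        · rw [sub_zero]
        · rw [Real.sin_sub_pi, abs_neg]
      rw [h1]
      have h2 := (one_fifth_mul_le_sin ht.1.le htp).trans (le_abs_self _)
      have h3 : t * (3 / 4) ≤ t * (Real.pi - t) := by
        have := ht.1
        gcongr; linarith [ht.2]
      have h4 : A * t * 4 < 9 / 10 * |Real.sin t| := by nlinarith [ht.1]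
      nlinarith
  have c2 : {t ∈ Icc (3 * Real.pi / 4) Real.pi | sqDistOsc A y s t - r ^ 2 = 0}.encard ≤ 2 := by
    refine encard_sqDistOsc_le_two (by linarith) r fun t ht => ?_
    refine sqDistOscDeriv₂_ne_zero hA hA1 hy (by linarith [ht.1]) ht.2.le ?_
    have h1 : |Real.cos (t - s)| = |Real.cos t| := by
      rcases hs with rfl | rfl
      · rw [sub_zero]
      · rw [Real.cos_sub_pi, abs_neg]
    rw [h1]
    exact (seven_tenths_le_neg_cos ht.1.le ht.2.le).trans (neg_le_abs _)
  refine encard_le_of_subset_union (m := 1) (n := 2) (by exact_mod_cast c1) c2 fun t ht => ?_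
  rcases le_total t (3 * Real.pi / 4) with h | h
  · exact Or.inl ⟨⟨ht.1.1, h⟩, ht.2⟩
  · exact Or.inr ⟨⟨h, ht.1.2⟩, ht.2⟩

end Counting

/-! ### Sphere counts for centres on the segment near the origin -/

theorem analyticOnNhd_polyOsc (A : ℝ) : AnalyticOnNhd ℝ (polyOsc A) (Ioi 0) := by
  intro t ht
  have h1 : AnalyticAt ℝ (fun t : ℝ => Real.pi ^ 2 / t) t :=
    analyticAt_const.div analyticAt_id (ne_of_gt ht)
  have h2 := Real.analyticAt_sin.comp h1
  exact (analyticAt_const.mul ((analyticAt_id.div_const).pow 3)).mul h2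

theorem analyticOnNhd_polyOscDeriv (A : ℝ) : AnalyticOnNhd ℝ (polyOscDeriv A) (Ioi 0) :=
  (analyticOnNhd_polyOsc A).deriv.congr isOpen_Ioi
    fun _ ht => (hasDerivAt_polyOsc A (ne_of_gt ht)).deriv

theorem exists_encard_sqDistOsc_Icc_le {A t₀ : ℝ} (hA : 0 < A) (ht₀ : 0 < t₀) :
    ∃ N : ℕ, ∀ x r, {t ∈ Icc t₀ Real.pi | sqDistOsc A x 0 t - r ^ 2 = 0}.encard ≤ N := by
  have hp := Real.pi_pos
  have hp0 := Real.pi_ne_zero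
  have han := (analyticOnNhd_polyOsc A)
  have hρ : AnalyticOnNhd ℝ (fun t => 1 + polyOsc A t) (Ioi 0) := analyticOnNhd_const.add han
  have hρ' := analyticOnNhd_polyOscDeriv A
  have hcos : AnalyticOnNhd ℝ Real.cos (Ioi 0) := fun t _ => Real.analyticAt_cos
  have hsin : AnalyticOnNhd ℝ Real.sin (Ioi 0) := fun t _ => Real.analyticAt_sin
  have e1 : polyOsc A (Real.pi / 2) = 0 := by
    have : Real.pi ^ 2 / (Real.pi / 2) = 2 * Real.pi := by field_simp
    rw [polyOsc, this, Real.sin_two_pi, mul_zero]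
  have e2 : polyOsc A Real.pi = 0 := by
    have : Real.pi ^ 2 / Real.pi = Real.pi := by field_simp
    rw [polyOsc, this, Real.sin_pi, mul_zero]
  have e3 : polyOscDeriv A (Real.pi / 2) = -A / 2 := by
    have : Real.pi ^ 2 / (Real.pi / 2) = 2 * Real.pi := by field_simp
    rw [polyOscDeriv, this, Real.sin_two_pi, Real.cos_two_pi]
    field_simp
    ring
  have e4 : polyOscDeriv A Real.pi = A := by
    have : Real.pi ^ 2 / Real.pi = Real.pi := by field_simp
    rw [polyOscDeriv, this, Real.sin_pi, Real.cos_pi]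
    field_simp
    ring
  -- Half the derivative of the squared distance is P - xQ. Here P/Q = A/2 at π/2 and P/Q = -1 at π,
  -- so P and Q are not proportional.
  obtain ⟨N, hN⟩ := AnalyticOnNhd.exists_encard_pencil_le
    (P := fun t => polyOscDeriv A t * (1 + polyOsc A t))
    (Q := fun t => polyOscDeriv A t * Real.cos t - (1 + polyOsc A t) * Real.sin t)
    (hρ'.mul hρ) ((hρ'.mul hcos).sub (hρ.mul hsin)) isPreconnected_Ioi isOpen_Ioi
    (t₁ := Real.pi / 2) (t₂ := Real.pi) (by simpa using hp) hp (by simp [e1])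
    (by simp [e1, e2, e3, e4]; nlinarith) (a := t₀) (b := Real.pi)
    (fun t ht => ht₀.trans_le ht.1)
  refine ⟨N + 1, fun x r => ?_⟩
  push_cast
  refine encard_zeros_le_succ ordConnected_Icc
    ((continuous_sqDistOsc A x 0).sub continuous_const).continuousOn
    (f' := sqDistOscDeriv A x 0) (fun t ht => ?_) ((encard_le_encard ?_).trans (hN x))
  · exact (hasDerivAt_sqDistOsc A x 0 (ht₀.trans_le (interior_subset ht).1).ne').sub_const _
  · rintro t ⟨ht, h0⟩
    refine ⟨interior_subset ht, ?_⟩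
    rw [sqDistOscDeriv, sub_zero] at h0
    linarith

/-- The perturbation terms in the derivative of `sqDistOsc A x 0` with respect to `π ^ 2 / t`. -/
theorem exists_nullCTwo_sqDistOscDeriv (A : ℝ) : ∃ α β : ℝ → ℝ, NullCTwo α ∧ NullCTwo β ∧
    ∀ x u, u ≠ 0 → sqDistOscDeriv A x 0 (Real.pi ^ 2 / u) * (-Real.pi ^ 2 / u ^ 2) =
      2 / u ^ 3 * (A * Real.pi ^ 3 * (1 - x) * Real.cos u + -(Real.pi ^ 4 * x) + α u + x * β u) := by
  have hp0 := Real.pi_ne_zero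
  -- With t = π²/u, `n₂` is ε₂(t), `n₃` is cos t - 1, `n₄` is u sin t - π², and ε₂'(t) = -(Aπ/u)(cos
  -- u + n₁).
  set n₁ : ℝ → ℝ := fun u => -3 * (1 / u * Real.sin u) with hn₁
  set n₂ : ℝ → ℝ := fun u => A * Real.pi ^ 3 * (1 / u * (1 / u * (1 / u * Real.sin u))) with hn₂
  set n₃ : ℝ → ℝ := fun u => Real.cos (Real.pi ^ 2 / u) - 1 with hn₃
  set n₄ : ℝ → ℝ := fun u => u * Real.sin (Real.pi ^ 2 / u) - Real.pi ^ 2 with hn₄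
  have h₁ : NullCTwo n₁ := (nullCTwo_inv.mul bddCTwo_sin).const_mul _
  have h₂ : NullCTwo n₂ := (nullCTwo_inv.mul
    (nullCTwo_inv.mul (nullCTwo_inv.mul bddCTwo_sin).bddCTwo).bddCTwo).const_mul _
  have h₃ : NullCTwo n₃ := nullCTwo_cos_const_div _
  have h₄ : NullCTwo n₄ := nullCTwo_mul_sin_const_div (pow_ne_zero 2 hp0)
  have hM : BddCTwo (fun u => Real.cos u + n₁ u) := bddCTwo_cos.add h₁.bddCTwo
  refine ⟨fun u => A * Real.pi ^ 3 * (n₁ u + n₂ u * (Real.cos u + n₁ u)),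
    fun u => -(A * Real.pi ^ 3) * (n₁ u + n₃ u * (Real.cos u + n₁ u)) +
      -Real.pi ^ 2 * (Real.pi ^ 2 * n₂ u + (n₄ u + n₂ u * n₄ u)),
    (h₁.add (h₂.mul hM)).const_mul _,
    ((h₁.add (h₃.mul hM)).const_mul _).add
      (((h₂.const_mul _).add (h₄.add (h₂.mul h₄.bddCTwo))).const_mul _), fun x u hu => ?_⟩
  have hdiv : Real.pi ^ 2 / (Real.pi ^ 2 / u) = u := by field_simp
  simp only [sqDistOscDeriv, polyOscDeriv, polyOsc, hdiv, sub_zero, hn₁, hn₂, hn₃, hn₄]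
  generalize Real.sin (Real.pi ^ 2 / u) = S
  generalize Real.cos (Real.pi ^ 2 / u) = C
  generalize Real.sin u = S'
  generalize Real.cos u = C'
  field_simp
  ring

theorem exists_encard_sqDistOsc_le {A : ℝ} (hA : 0 < A) : ∃ N : ℕ, ∀ x, 0 ≤ x → x ≤ 1 / 2 →
    ∀ r τ, 0 < τ → τ ≤ 2 → ∃ n : ℕ,
      {t ∈ Icc τ Real.pi | sqDistOsc A x 0 t - r ^ 2 = 0}.encard ≤ n ∧ n * τ ≤ N := by
  have hp := Real.pi_pos
  have hp4 := Real.pi_lt_four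
  obtain ⟨α, β, hα, hβ, hderiv⟩ := exists_nullCTwo_sqDistOscDeriv A
  obtain ⟨k₀, hk₀⟩ := Filter.eventually_atTop.1
    (eventually_encard_cos_add_le_two (c := A * Real.pi ^ 3) (by positivity) hα hβ)
  set a : ℕ → ℝ := fun k => Real.pi / 4 + k * (Real.pi / 2) with ha
  have hapos : ∀ k, 0 < a k := fun k => by simp only [ha]; positivity
  have hasucc : ∀ k : ℕ, Real.pi / 4 + ((k : ℝ) + 1) * (Real.pi / 2) = a (k + 1) := fun k => by
    simp only [ha]; push_cast; rfl
  obtain ⟨N₀, hN₀⟩ := exists_encard_sqDistOsc_Icc_le hA (t₀ := Real.pi ^ 2 / a k₀)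
    (div_pos (by positivity) (hapos k₀))
  -- With n = N₀ + 3m and mτ ≤ 2π + τ, nτ ≤ 2N₀ + 3(8 + 2).
  refine ⟨2 * N₀ + 30, fun x hx0 hx1 r τ hτ hτ2 => ?_⟩
  have hJ : ∀ k, {u ∈ Icc (a (k₀ + k)) (a (k₀ + k + 1)) |
      sqDistOsc A x 0 (Real.pi ^ 2 / u) - r ^ 2 = 0}.encard ≤ 3 := by
    intro k
    have hpos : ∀ u ∈ Icc (a (k₀ + k)) (a (k₀ + k + 1)), 0 < u := fun u hu =>
      (hapos _).trans_le hu.1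
    have hd : ∀ u ∈ Icc (a (k₀ + k)) (a (k₀ + k + 1)),
        HasDerivAt (fun u => sqDistOsc A x 0 (Real.pi ^ 2 / u) - r ^ 2)
          (sqDistOscDeriv A x 0 (Real.pi ^ 2 / u) * (-Real.pi ^ 2 / u ^ 2)) u := fun u hu =>
      ((hasDerivAt_sqDistOsc A x 0 (div_pos (by positivity) (hpos u hu)).ne').comp u
        (hasDerivAt_const_div _ (hpos u hu).ne')).sub_const _
    refine encard_zeros_le_succ (n := 2) ordConnected_Icc
      (fun u hu => (hd u hu).continuousAt.continuousWithinAt)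
      (fun u hu => hd u (interior_subset hu)) ?_
    refine (encard_le_encard ?_).trans
      (hk₀ (k₀ + k) (Nat.le_add_right _ _) x hx0 hx1 (-(Real.pi ^ 4 * x)))
    rintro u ⟨hu, h0⟩
    have hu' := interior_subset hu
    refine ⟨?_, ?_⟩
    · rw [hasucc]; exact hu'
    · rw [hderiv x u (hpos u hu').ne'] at h0
      exact (mul_eq_zero.1 h0).resolve_left
        (div_pos two_pos (pow_pos (hpos u hu') 3)).ne'
  -- The range t ≥ τ means u ≤ π²/τ, covered beyond `a k₀` by at most this many intervals of length
  -- π/2.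
  set m : ℕ := ⌈2 * Real.pi / τ⌉₊ with hm
  refine ⟨N₀ + m * 3, ?_, ?_⟩
  · have hinj : Set.InjOn (fun t : ℝ => Real.pi ^ 2 / t)
        {t ∈ Icc τ Real.pi | t ≤ Real.pi ^ 2 / a k₀ ∧ sqDistOsc A x 0 t - r ^ 2 = 0} := by
      intro s hs t ht hst
      have h1 : s ≠ 0 := (hτ.trans_le hs.1.1).ne'
      have h2 : t ≠ 0 := (hτ.trans_le ht.1.1).ne'
      simp only at hst
      field_simp at hst
      exact hst.symm
    have hmaps : MapsTo (fun t : ℝ => Real.pi ^ 2 / t)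
        {t ∈ Icc τ Real.pi | t ≤ Real.pi ^ 2 / a k₀ ∧ sqDistOsc A x 0 t - r ^ 2 = 0}
        (⋃ k < m, {u ∈ Icc (a (k₀ + k)) (a (k₀ + k + 1)) |
          sqDistOsc A x 0 (Real.pi ^ 2 / u) - r ^ 2 = 0}) := by
      rintro t ⟨ht, htk, h0⟩
      have ht0 : 0 < t := hτ.trans_le ht.1
      have hu : a k₀ ≤ Real.pi ^ 2 / t := by
        rw [le_div_iff₀ (hapos _)] at htk
        rw [le_div_iff₀ ht0]; linarith
      have hquot : 0 ≤ (Real.pi ^ 2 / t - a k₀) / (Real.pi / 2) :=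
        div_nonneg (by linarith) (by positivity)
      simp only [mem_iUnion, exists_prop]
      refine ⟨⌊(Real.pi ^ 2 / t - a k₀) / (Real.pi / 2)⌋₊, ?_, ⟨?_, ?_⟩, ?_⟩
      · rw [Nat.floor_lt hquot]
        refine lt_of_lt_of_le ?_ (Nat.le_ceil _)
        rw [div_lt_iff₀ (by positivity)]
        have h1 : Real.pi ^ 2 / t ≤ Real.pi ^ 2 / τ := by gcongr; exact ht.1
        have h2 : 2 * Real.pi / τ * (Real.pi / 2) = Real.pi ^ 2 / τ := by ring
        linarith [hapos k₀]
      · have := Nat.floor_le hquot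
        rw [le_div_iff₀ (by positivity)] at this
        simp only [ha] at this ⊢
        push_cast
        linarith
      · have := (Nat.lt_floor_add_one ((Real.pi ^ 2 / t - a k₀) / (Real.pi / 2))).le
        rw [div_le_iff₀ (by positivity)] at this
        simp only [ha] at this ⊢
        push_cast
        linarith
      · have : Real.pi ^ 2 / (Real.pi ^ 2 / t) = t := by field_simp
        rw [this]; exact h0
    refine encard_le_of_subset_union (hN₀ x r) ((encard_le_encard_of_injOn hmaps hinj).trans
      (encard_biUnion_lt_le (fun k => hJ k) m)) fun t ht => ?_
    rcases le_total t (Real.pi ^ 2 / a k₀) with h | h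
    · exact Or.inr ⟨ht.1, h, ht.2⟩
    · exact Or.inl ⟨⟨h, ht.1.2⟩, ht.2⟩
  · have h1 : (m : ℝ) < 2 * Real.pi / τ + 1 := Nat.ceil_lt_add_one (by positivity)
    have h2 : (m : ℝ) * τ ≤ 2 * Real.pi + τ := by
      calc (m : ℝ) * τ ≤ (2 * Real.pi / τ + 1) * τ := by gcongr
        _ = _ := by field_simp
    push_cast
    have h3 : (N₀ : ℝ) * τ ≤ N₀ * 2 := by gcongr
    nlinarith

/-! ### The bi-Lipschitz parametrization of the curve -/

/-- The point of polar coordinates `(a, t)`. -/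
noncomputable def polarPoint (a t : ℝ) : ℂ := ⟨a * Real.cos t, a * Real.sin t⟩

theorem dist_polarPoint_sq (a t b s : ℝ) : dist (polarPoint a t) (polarPoint b s) ^ 2 =
    a ^ 2 - 2 * a * b * Real.cos (t - s) + b ^ 2 := by
  rw [Complex.dist_eq, Complex.sq_norm, Complex.normSq_apply, Real.cos_sub]
  simp only [polarPoint, Complex.sub_re, Complex.sub_im]
  linear_combination a ^ 2 * Real.sin_sq_add_cos_sq t + b ^ 2 * Real.sin_sq_add_cos_sq s

theorem polarPoint_zero_right (a : ℝ) : polarPoint a 0 = (a : ℂ) := by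
  apply Complex.ext <;> simp [polarPoint]

theorem polarPoint_pi (a : ℝ) : polarPoint a Real.pi = ((-a : ℝ) : ℂ) := by
  apply Complex.ext <;> simp [polarPoint]

section Curve

variable {A : ℝ}

theorem polyOsc_zero (A : ℝ) : polyOsc A 0 = 0 := by simp [polyOsc]

theorem polyOsc_pi (A : ℝ) : polyOsc A Real.pi = 0 := by
  have : Real.pi ^ 2 / Real.pi = Real.pi := by field_simp
  rw [polyOsc, this, Real.sin_pi, mul_zero]

theorem perturbedCurve_of_nonpos (A : ℝ) {t : ℝ} (ht : t ≤ 0) :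
    perturbedCurve (polyOsc A) t = polarPoint (t + 1) 0 := by
  rw [perturbedCurve, if_pos ht, polarPoint_zero_right]

theorem perturbedCurve_of_pi_le (A : ℝ) {t : ℝ} (ht : Real.pi ≤ t) :
    perturbedCurve (polyOsc A) t = polarPoint (t + 1 - Real.pi) Real.pi := by
  rw [perturbedCurve, if_neg (by linarith [Real.pi_pos]), if_neg (not_lt.2 ht), polarPoint_pi]
  congr 1; ring

theorem perturbedCurve_of_mem_Icc (A : ℝ) {t : ℝ} (ht : t ∈ Icc 0 Real.pi) :
    perturbedCurve (polyOsc A) t = polarPoint (1 + polyOsc A t) t := by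
  rcases ht.1.eq_or_lt with rfl | h0
  · rw [perturbedCurve_of_nonpos A le_rfl, polyOsc_zero]; norm_num
  rcases ht.2.eq_or_lt with rfl | hp
  · rw [perturbedCurve_of_pi_le A le_rfl, polyOsc_pi]; congr 1; ring
  rw [perturbedCurve, if_neg (not_le.2 h0), if_pos hp]; rfl

theorem dist_perturbedCurve_le_of_glue {a b : ℝ} {f : ℝ → ℂ} {K : ℝ}
    (h1 : ∀ s t, a ≤ s → s ≤ t → t ≤ b → dist (f s) (f t) ≤ K * (t - s))
    (h2 : ∀ s t, b ≤ s → s ≤ t → dist (f s) (f t) ≤ K * (t - s)) :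
    ∀ s t, a ≤ s → s ≤ t → dist (f s) (f t) ≤ K * (t - s) := by
  intro s t hs hst
  rcases le_total t b with h | h
  · exact h1 s t hs hst h
  rcases le_total b s with h' | h'
  · exact h2 s t h' hst
  calc _ ≤ dist (f s) (f b) + dist (f b) (f t) := dist_triangle _ _ _
    _ ≤ K * (b - s) + K * (t - b) := add_le_add (h1 s b hs h' le_rfl) (h2 b t le_rfl h)
    _ = _ := by ring

theorem dist_perturbedCurve_le (hA : 0 < A) (hA1 : A < 1 / 1000) (s t : ℝ) (hst : s ≤ t) :
    dist (perturbedCurve (polyOsc A) s) (perturbedCurve (polyOsc A) t) ≤ 2 * (t - s) := by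
  refine dist_perturbedCurve_le_of_glue (a := s) (b := 0) ?_ ?_ s t le_rfl hst
  · intro s t _ hst ht
    refine abs_le_of_sq_le_sq' ?_ (by linarith) |>.2
    rw [perturbedCurve_of_nonpos A (hst.trans ht), perturbedCurve_of_nonpos A ht,
      dist_polarPoint_sq, sub_self, Real.cos_zero]
    nlinarith [sq_nonneg (t - s)]
  refine dist_perturbedCurve_le_of_glue (b := Real.pi) ?_ ?_
  · intro s t hs hst ht
    refine abs_le_of_sq_le_sq' ?_ (by linarith) |>.2
    have hs' : s ∈ Icc 0 Real.pi := ⟨hs, hst.trans ht⟩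
    have ht' : t ∈ Icc 0 Real.pi := ⟨hs.trans hst, ht⟩
    rw [perturbedCurve_of_mem_Icc A hs', perturbedCurve_of_mem_Icc A ht', dist_polarPoint_sq]
    have e1 := abs_le.1 (abs_polyOsc_le_amplitude hA.le hs'.1 hs'.2)
    have e2 := abs_le.1 (abs_polyOsc_le_amplitude hA.le ht'.1 ht'.2)
    have e3 := abs_polyOsc_sub_le hA.le hs' ht'
    have e4 : (polyOsc A s - polyOsc A t) ^ 2 ≤ (t - s) ^ 2 := by
      refine sq_le_sq.2 (e3.trans ?_)
      rw [abs_sub_comm t s]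
      nlinarith [abs_nonneg (s - t)]
    have e5 := Real.one_sub_sq_div_two_le_cos (x := s - t)
    have e6 : (1 + polyOsc A s) * (1 + polyOsc A t) ≤ 2 := by nlinarith
    have e7 : (1 + polyOsc A s) * (1 + polyOsc A t) * (1 - Real.cos (s - t)) ≤ 2 * ((s - t) ^ 2 / 2) :=
      mul_le_mul e6 (by linarith) (by linarith [Real.cos_le_one (s - t)]) zero_le_two
    nlinarith
  · intro s t hs hst
    refine abs_le_of_sq_le_sq' ?_ (by linarith) |>.2
    rw [perturbedCurve_of_pi_le A hs, perturbedCurve_of_pi_le A (hs.trans hst),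
      dist_polarPoint_sq, sub_self, Real.cos_zero]
    nlinarith [sq_nonneg (t - s)]

theorem cos_le_one_sub_sq_div_five {v : ℝ} (hv : |v| ≤ Real.pi) :
    Real.cos v ≤ 1 - v ^ 2 / 5 := by
  refine (Real.cos_le_one_sub_mul_cos_sq hv).trans ?_
  have : (1 : ℝ) / 5 ≤ 2 / Real.pi ^ 2 := by
    rw [div_le_div_iff₀ (by norm_num) (by have := Real.pi_pos; positivity)]
    nlinarith [Real.pi_lt_d2, Real.pi_gt_three]
  nlinarith [sq_nonneg v]

/-- The squared distance of two polar points is (a - b)² + 2ab(1 - cos), and 1 - cos v ≥ v²/5 for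
|v| ≤ π. The perturbation, with Lipschitz constant at most 4A, is absorbed. -/
theorem sub_le_dist_perturbedCurve (hA : 0 < A) (hA1 : A < 1 / 1000) (s t : ℝ) (hs : -1 ≤ s)
    (hst : s ≤ t) :
    t - s ≤ 20 * dist (perturbedCurve (polyOsc A) s) (perturbedCurve (polyOsc A) t) := by
  have hp3 := Real.pi_gt_three
  have hp4 := Real.pi_lt_d2
  refine abs_le_of_sq_le_sq' ?_ (by positivity) |>.2
  rw [mul_pow]
  rcases le_total s 0 with hs0 | hs0
  · rw [perturbedCurve_of_nonpos A hs0]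
    rcases le_total t 0 with ht0 | ht0
    · rw [perturbedCurve_of_nonpos A ht0, dist_polarPoint_sq, sub_self, Real.cos_zero]
      nlinarith [sq_nonneg (t - s)]
    rcases le_total t Real.pi with htp | htp
    · have ht : t ∈ Icc 0 Real.pi := ⟨ht0, htp⟩
      rw [perturbedCurve_of_mem_Icc A ht, dist_polarPoint_sq, zero_sub, Real.cos_neg]
      have e1 := abs_le.1 (abs_polyOsc_le_amplitude hA.le ht0 htp)
      -- Close to the corner at 1 the angular part controls t and the radial part controls s.
      -- Otherwise the two points are at distance at least 4/10 while t - s ≤ 5.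
      rcases le_total (1 / 2) (s + 1) with hx | hx
      · have e2 := abs_polyOsc_sub_le hA.le ht ⟨le_rfl, Real.pi_pos.le⟩
        rw [polyOsc_zero, sub_zero, sub_zero, abs_of_nonneg ht0] at e2
        have e3 : polyOsc A t ^ 2 ≤ (t / 100) ^ 2 := by
          rw [← sq_abs]
          exact pow_le_pow_left₀ (abs_nonneg _) (e2.trans (by nlinarith)) 2
        have e4 := cos_le_one_sub_sq_div_five (v := t) (by rwa [abs_of_nonneg ht0])
        have e5 : 1 / 2 * (9 / 10) ≤ (s + 1) * (1 + polyOsc A t) :=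
          mul_le_mul hx (by linarith) (by norm_num) (by linarith)
        have e6 : 1 / 2 * (9 / 10) * (t ^ 2 / 5) ≤
            (s + 1) * (1 + polyOsc A t) * (1 - Real.cos t) :=
          mul_le_mul e5 (by linarith) (by positivity) (le_trans (by norm_num) e5)
        linarith [sq_nonneg (s - 2 * polyOsc A t), sq_nonneg (t + s), sq_nonneg s, sq_nonneg t]
      · have e2 : 0 ≤ (s + 1) * (1 + polyOsc A t) * (1 - Real.cos t) :=
          mul_nonneg (mul_nonneg (by linarith) (by linarith)) (by linarith [Real.cos_le_one t])
        have e3 : (4 / 10) ^ 2 ≤ (1 + polyOsc A t - (s + 1)) ^ 2 :=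
          pow_le_pow_left₀ (by norm_num) (by linarith) 2
        have e4 : (t - s) ^ 2 ≤ 5 ^ 2 := pow_le_pow_left₀ (by linarith) (by linarith) 2
        nlinarith
    · rw [perturbedCurve_of_pi_le A htp, dist_polarPoint_sq, zero_sub, Real.cos_neg, Real.cos_pi]
      have : (t - s) ^ 2 ≤ (20 * (s + 1 + (t + 1 - Real.pi))) ^ 2 :=
        pow_le_pow_left₀ (by linarith) (by linarith) 2
      nlinarith
  have ht0 := hs0.trans hst
  rcases le_total s Real.pi with hsp | hsp
  · have hs' : s ∈ Icc 0 Real.pi := ⟨hs0, hsp⟩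
    rw [perturbedCurve_of_mem_Icc A hs']
    have e1 := abs_le.1 (abs_polyOsc_le_amplitude hA.le hs0 hsp)
    rcases le_total t Real.pi with htp | htp
    · have ht : t ∈ Icc 0 Real.pi := ⟨ht0, htp⟩
      rw [perturbedCurve_of_mem_Icc A ht, dist_polarPoint_sq]
      have e2 := abs_le.1 (abs_polyOsc_le_amplitude hA.le ht0 htp)
      have e4 := cos_le_one_sub_sq_div_five (v := s - t)
        (by rw [abs_sub_comm, abs_of_nonneg (by linarith)]; linarith)
      have e5 : 9 / 10 * (9 / 10) ≤ (1 + polyOsc A s) * (1 + polyOsc A t) :=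
        mul_le_mul (by linarith) (by linarith) (by norm_num) (by linarith)
      have e6 : 9 / 10 * (9 / 10) * ((s - t) ^ 2 / 5) ≤
          (1 + polyOsc A s) * (1 + polyOsc A t) * (1 - Real.cos (s - t)) :=
        mul_le_mul e5 (by linarith) (by positivity) (le_trans (by norm_num) e5)
      linarith [sq_nonneg (polyOsc A s - polyOsc A t), sq_nonneg (s - t)]
    · rw [perturbedCurve_of_pi_le A htp, dist_polarPoint_sq]
      have e2 := abs_polyOsc_sub_le hA.le hs' ⟨Real.pi_pos.le, le_rfl⟩
      rw [polyOsc_pi, sub_zero, abs_sub_comm, abs_of_nonneg (sub_nonneg.2 hsp)] at e2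
      have e3 : polyOsc A s ^ 2 ≤ ((Real.pi - s) / 100) ^ 2 := by
        rw [← sq_abs]
        exact pow_le_pow_left₀ (abs_nonneg _) (e2.trans (by nlinarith)) 2
      have e4 := cos_le_one_sub_sq_div_five (v := s - Real.pi)
        (by rw [abs_sub_comm, abs_of_nonneg (by linarith)]; linarith)
      have e5 : 9 / 10 * 1 ≤ (1 + polyOsc A s) * (t + 1 - Real.pi) :=
        mul_le_mul (by linarith) (by linarith) (by norm_num) (by linarith)
      have e6 : 9 / 10 * 1 * ((s - Real.pi) ^ 2 / 5) ≤
          (1 + polyOsc A s) * (t + 1 - Real.pi) * (1 - Real.cos (s - Real.pi)) :=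
        mul_le_mul e5 (by linarith) (by positivity) (le_trans (by norm_num) e5)
      linarith [sq_nonneg ((t - Real.pi) - 2 * polyOsc A s), sq_nonneg (t - Real.pi),
        sq_nonneg ((t - Real.pi) - (Real.pi - s)), sq_nonneg (Real.pi - s)]
  · rw [perturbedCurve_of_pi_le A hsp, perturbedCurve_of_pi_le A (hsp.trans hst),
      dist_polarPoint_sq, sub_self, Real.cos_zero]
    nlinarith [sq_nonneg (t - s)]

/-- The parametrization of `XTwo A`, extended by a constant to the left of `-1`. -/
noncomputable def chartXTwo (A t : ℝ) : XTwo A :=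
  ⟨perturbedCurve (polyOsc A) (max (-1) t), mem_image_of_mem _ (mem_Ici.2 (le_max_left _ _))⟩

theorem coe_chartXTwo (A : ℝ) {t : ℝ} (ht : -1 ≤ t) :
    (chartXTwo A t : ℂ) = perturbedCurve (polyOsc A) t := by
  show perturbedCurve (polyOsc A) (max (-1) t) = _
  rw [max_eq_right ht]

theorem isChordArcChart_chartXTwo (hA : 0 < A) (hA1 : A < 1 / 1000) :
    IsChordArcChart (chartXTwo A) (-1) 20 where
  exists_eq := by
    rintro ⟨_, t, ht, rfl⟩
    exact ⟨t, ht, Subtype.ext (coe_chartXTwo A ht)⟩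
  dist_le := by
    intro s t hs ht
    rw [Subtype.dist_eq, coe_chartXTwo A hs, coe_chartXTwo A ht]
    rcases le_total s t with h | h
    · have := dist_perturbedCurve_le hA hA1 s t h
      rw [abs_sub_comm, abs_of_nonneg (sub_nonneg.2 h)]
      push_cast; linarith
    · have := dist_perturbedCurve_le hA hA1 t s h
      rw [dist_comm, abs_of_nonneg (sub_nonneg.2 h)]
      push_cast; linarith
  abs_sub_le := by
    intro s t hs ht
    rw [Subtype.dist_eq, coe_chartXTwo A hs, coe_chartXTwo A ht]
    rcases le_total s t with h | h
    · have := sub_le_dist_perturbedCurve hA hA1 s t hs h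
      rw [abs_sub_comm, abs_of_nonneg (sub_nonneg.2 h)]
      push_cast; linarith
    · have := sub_le_dist_perturbedCurve hA hA1 t s ht h
      rw [dist_comm, abs_of_nonneg (sub_nonneg.2 h)]
      push_cast; linarith

/-! ### Layer decay -/

theorem encard_sq_add_const_le_two {I : Set ℝ} (hI : I.OrdConnected) (a b : ℝ) :
    {t ∈ I | (t - a) ^ 2 + b = 0}.encard ≤ 2 :=
  encard_zeros_le_two (f' := fun t => 2 * (t - a)) (f'' := fun _ => 2) hI
    (by fun_prop)
    (fun t _ => ((((hasDerivAt_id' t).sub_const a).pow 2).add_const b).congr_deriv (by norm_num))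
    (fun t _ => (((hasDerivAt_id' t).sub_const a).const_mul 2).congr_deriv (by norm_num))
    (fun t _ => two_ne_zero)

theorem dist_eq_iff_sqDistOsc (A : ℝ) {y s t r : ℝ} (ht : t ∈ Icc 0 Real.pi) (hr : 0 ≤ r) :
    dist (perturbedCurve (polyOsc A) t) (polarPoint y s) = r ↔
      sqDistOsc A y s t - r ^ 2 = 0 := by
  rw [← sq_eq_sq₀ dist_nonneg hr, perturbedCurve_of_mem_Icc A ht, dist_polarPoint_sq, sub_eq_zero]
  rfl

/-- Each straight piece gives a quadratic equation, hence at most two crossings. Only centres on the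
segment at distance at most 1/2 from the origin can fall in the second alternative. -/
theorem layerDecayWith_lengthXTwo (hA : 0 < A) (hA1 : A < 1 / 1000) :
    LayerDecayWith (lengthXTwo A) (1 / 2) := by
  obtain ⟨N, hN⟩ := exists_encard_sqDistOsc_le hA
  have hp := Real.pi_pos
  refine (isChordArcChart_chartXTwo hA hA1).layerDecayWith_half (N + 10) fun z r hr => ?_
  obtain ⟨s, hs, rfl⟩ := (isChordArcChart_chartXTwo hA hA1).exists_eq z
  set S : Set ℝ := {t | -1 ≤ t ∧ dist (chartXTwo A t) (chartXTwo A s) = r}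
  obtain ⟨y, θ, hz⟩ : ∃ y θ, perturbedCurve (polyOsc A) s = polarPoint y θ := by
    rcases le_total s 0 with h | h
    · exact ⟨_, _, perturbedCurve_of_nonpos A h⟩
    rcases le_total s Real.pi with h' | h'
    · exact ⟨_, _, perturbedCurve_of_mem_Icc A ⟨h, h'⟩⟩
    · exact ⟨_, _, perturbedCurve_of_pi_le A h'⟩
  have hS : ∀ t ∈ S, -1 ≤ t ∧
      dist (perturbedCurve (polyOsc A) t) (perturbedCurve (polyOsc A) s) = r := by
    rintro t ⟨ht, hd⟩
    rw [Subtype.dist_eq, coe_chartXTwo A ht, coe_chartXTwo A hs] at hd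
    exact ⟨ht, hd⟩
  have hseg : (S ∩ Iic 0).encard ≤ 2 := by
    refine (encard_le_encard ?_).trans (encard_sq_add_const_le_two (I := Iic 0) ordConnected_Iic
      (y * Real.cos θ - 1) ((y * Real.sin θ) ^ 2 - r ^ 2))
    rintro t ⟨ht, ht0⟩
    refine ⟨ht0, ?_⟩
    have h1 := congrArg (· ^ 2) (hS t ht).2
    rw [hz, perturbedCurve_of_nonpos A ht0, dist_polarPoint_sq, zero_sub, Real.cos_neg] at h1
    linear_combination h1 + y ^ 2 * Real.sin_sq_add_cos_sq θ
  have hray : (S ∩ Ici Real.pi).encard ≤ 2 := by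
    refine (encard_le_encard ?_).trans (encard_sq_add_const_le_two (I := Ici Real.pi)
      ordConnected_Ici (-(y * Real.cos θ) + Real.pi - 1) ((y * Real.sin θ) ^ 2 - r ^ 2))
    rintro t ⟨ht, ht0⟩
    refine ⟨ht0, ?_⟩
    have h1 := congrArg (· ^ 2) (hS t ht).2
    rw [hz, perturbedCurve_of_pi_le A ht0, dist_polarPoint_sq, Real.cos_pi_sub] at h1
    linear_combination h1 + y ^ 2 * Real.sin_sq_add_cos_sq θ
  have hunion : ∀ (T : Set ℝ) (n : ℕ), T ⊆ S → (T ∩ Icc 0 Real.pi).encard ≤ n →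
      T.encard ≤ (n + 4 : ℕ) := by
    intro T n hT hn
    have h1 := encard_le_of_subset_union (m := 2) (n := 2)
      ((encard_le_encard (inter_subset_inter_left _ hT)).trans hseg)
      ((encard_le_encard (inter_subset_inter_left _ hT)).trans hray) Subset.rfl
    refine encard_le_of_subset_union (n := 4) hn h1 fun t ht => ?_
    rcases le_total t 0 with h | h
    · exact Or.inr (Or.inl ⟨ht, h⟩)
    rcases le_total t Real.pi with h' | h'
    · exact Or.inl ⟨ht, h, h'⟩
    · exact Or.inr (Or.inr ⟨ht, h'⟩)
  have hsub : ∀ (a y θ : ℝ), 0 ≤ a → perturbedCurve (polyOsc A) s = polarPoint y θ →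
      S ∩ Icc a Real.pi ⊆ {t ∈ Icc a Real.pi | sqDistOsc A y θ t - r ^ 2 = 0} := by
    rintro a y θ ha hyθ t ⟨ht, hta⟩
    refine ⟨hta, (dist_eq_iff_sqDistOsc A ⟨ha.trans hta.1, hta.2⟩ hr.le).1 ?_⟩
    rw [← hyθ]; exact (hS t ht).2
  have hreg : (S ∩ Icc 0 Real.pi).encard ≤ 4 → S.encard ≤ (N + 10 : ℕ) := fun h =>
    (hunion S 4 Subset.rfl h).trans (by exact_mod_cast Nat.le_add_left 8 (N + 2))
  rcases le_total s 0 with hs0 | hs0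
  · have hx := perturbedCurve_of_nonpos A hs0
    rcases le_total (1 / 2) (s + 1) with hx2 | hx2
    · exact Or.inl (hreg ((encard_le_encard (hsub 0 _ _ le_rfl hx)).trans
        ((encard_sqDistOsc_axis_le hA hA1 hx2 (Or.inl rfl) r).trans (by norm_num))))
    -- The bounds on r follow only when the sphere meets the arc; otherwise there is nothing to
    -- count on it.
    rcases (S ∩ Icc 0 Real.pi).eq_empty_or_nonempty with he | ⟨t, htS, ht⟩
    · exact Or.inl (hreg (by rw [he]; simp))
    right
    have e1 := abs_le.1 (abs_polyOsc_le_amplitude hA.le ht.1 ht.2)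
    have h1 := congrArg (· ^ 2) (hS t htS).2
    rw [hx, perturbedCurve_of_mem_Icc A ht, dist_polarPoint_sq, sub_zero] at h1
    have h2 : 0 ≤ (1 + polyOsc A t) * (s + 1) := mul_nonneg (by linarith) (by linarith)
    have h3 : (1 + polyOsc A t) * (s + 1) * Real.cos t ≤ (1 + polyOsc A t) * (s + 1) :=
      mul_le_of_le_one_right h2 (Real.cos_le_one t)
    have h4 : -((1 + polyOsc A t) * (s + 1)) ≤ (1 + polyOsc A t) * (s + 1) * Real.cos t := by
      nlinarith [Real.neg_one_le_cos t]
    refine ⟨?_, ?_, fun τ hτ hτ2 => ?_⟩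
    · refine abs_le_of_sq_le_sq' ?_ hr.le |>.2
      have : (4 / 10) ^ 2 ≤ (1 + polyOsc A t - (s + 1)) ^ 2 :=
        pow_le_pow_left₀ (by norm_num) (by linarith) 2
      nlinarith
    · refine abs_le_of_sq_le_sq' ?_ (by norm_num) |>.2
      have : (1 + polyOsc A t + (s + 1)) ^ 2 ≤ 3 ^ 2 :=
        pow_le_pow_left₀ (by linarith) (by linarith) 2
      nlinarith
    · obtain ⟨n, hn, hnτ⟩ := hN (s + 1) (by linarith) hx2 r τ hτ hτ2
      -- The extra 1 is the parameter 0, which the open interval does not discard.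
      refine ⟨n + 1 + 4, hunion _ (n + 1) sdiff_subset ?_, ?_⟩
      · have h0 : ({0} : Set ℝ).encard ≤ (1 : ℕ) := by simp
        refine encard_le_of_subset_union hn h0 fun u hu => ?_
        rcases hu.2.1.eq_or_lt with h | h
        · exact Or.inr h.symm
        · have hτu : τ ≤ u := by
            by_contra hlt
            exact hu.1.2 ⟨h, not_le.1 hlt⟩
          exact Or.inl (hsub τ _ _ hτ.le hx ⟨hu.1.1, hτu, hu.2.2⟩)
      · push_cast; nlinarith
  rcases le_total s Real.pi with hsp | hsp
  · exact Or.inl (hreg ((encard_le_encard (hsub 0 _ _ le_rfl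
      (perturbedCurve_of_mem_Icc A ⟨hs0, hsp⟩))).trans
      (encard_sqDistOsc_arc_le hA hA1 ⟨hs0, hsp⟩ r)))
  · exact Or.inl (hreg ((encard_le_encard (hsub 0 _ _ le_rfl
      (perturbedCurve_of_pi_le A hsp))).trans
      ((encard_sqDistOsc_axis_le hA hA1 (by linarith) (Or.inr rfl) r).trans (by norm_num))))

end Curve

section Failure

variable {A : ℝ}

theorem dist_chartXTwo_le (hA : 0 < A) (hA1 : A < 1 / 1000) {s t : ℝ} (hs : -1 ≤ s)
    (ht : -1 ≤ t) : dist (chartXTwo A s) (chartXTwo A t) ≤ 2 * |s - t| := by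
  rw [Subtype.dist_eq, coe_chartXTwo A hs, coe_chartXTwo A ht]
  rcases le_total s t with h | h
  · rw [abs_sub_comm, abs_of_nonneg (sub_nonneg.2 h)]
    exact dist_perturbedCurve_le hA hA1 s t h
  · rw [dist_comm, abs_of_nonneg (sub_nonneg.2 h)]
    exact dist_perturbedCurve_le hA hA1 t s h

theorem dist_chartXTwo_center (hA : 0 < A) (hA1 : A < 1 / 1000) {t : ℝ}
    (ht : t ∈ Icc 0 Real.pi) : dist (chartXTwo A t) (chartXTwo A (-1)) = 1 + polyOsc A t := by
  have he := abs_le.1 (abs_polyOsc_le_amplitude hA.le ht.1 ht.2)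
  rw [← sq_eq_sq₀ dist_nonneg (by linarith), Subtype.dist_eq,
    coe_chartXTwo A (by linarith [ht.1]), coe_chartXTwo A le_rfl, perturbedCurve_of_mem_Icc A ht,
    perturbedCurve_of_nonpos A (by norm_num), dist_polarPoint_sq]
  ring

theorem ofReal_length_le_measure_image (hA : 0 < A) (hA1 : A < 1 / 1000) {T : Set ℝ}
    (hT : T ⊆ Ici (-1)) {ℓ : ℝ} (hℓ : ENNReal.ofReal (20 * ℓ) ≤ volume T) :
    ENNReal.ofReal ℓ ≤ lengthXTwo A (chartXTwo A '' T) := by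
  have h1 := hℓ.trans ((isChordArcChart_chartXTwo hA hA1).volume_le hT)
  rw [ENNReal.ofReal_mul (by norm_num)] at h1
  have h2 : ENNReal.ofReal 20 = ((20 : ℝ≥0) : ℝ≥0∞) := by
    rw [← ENNReal.ofReal_coe_nnreal]; norm_num
  rw [h2] at h1
  exact (ENNReal.mul_le_mul_iff_right (by norm_num) ENNReal.coe_ne_top).1 h1

theorem lengthXTwo_ball_le (hA : 0 < A) (hA1 : A < 1 / 1000) (x : XTwo A) (r : ℝ) :
    lengthXTwo A (ball x r) ≤ ENNReal.ofReal (800 * r) := by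
  refine ((isChordArcChart_chartXTwo hA hA1).measure_ball_le x r).trans_eq ?_
  congr 1
  push_cast
  ring

/-! ### Failure of the relative layer decay property -/

/-- In the variable π²/t every value of the sine recurs within 2π, a displacement of at most (2/π)t²
in t. -/
theorem exists_near_sin_eq {t : ℝ} (ht : 0 < t) (c : ℝ) :
    ∃ t', 0 < t' ∧ t' ≤ t ∧ t - t' ≤ t ^ 2 ∧ Real.sin (Real.pi ^ 2 / t') = Real.sin c := by
  have hp := Real.pi_pos
  have hp3 := Real.pi_gt_three
  set u := Real.pi ^ 2 / t with hu
  have hu0 : 0 < u := by positivity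
  set k : ℤ := ⌈(u - c) / (2 * Real.pi)⌉ with hk
  set u' := c + k * (2 * Real.pi) with hu'
  have h1 : u ≤ u' := by
    have := Int.le_ceil ((u - c) / (2 * Real.pi))
    rw [div_le_iff₀ (by positivity)] at this
    linarith
  have h2 : u' ≤ u + 2 * Real.pi := by
    have := (Int.ceil_lt_add_one ((u - c) / (2 * Real.pi))).le
    rw [← sub_le_iff_le_add, le_div_iff₀ (by positivity)] at this
    linarith
  have hu'0 : 0 < u' := hu0.trans_le h1
  have htu : t = Real.pi ^ 2 / u := by rw [hu]; field_simp
  refine ⟨Real.pi ^ 2 / u', by positivity, ?_, ?_, ?_⟩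
  · rw [htu]; gcongr
  · have h3 : t - Real.pi ^ 2 / u' = t * ((u' - u) / u') := by
      rw [htu]; field_simp
    have h4 : (u' - u) / u' ≤ 2 * Real.pi / u := by
      have h5 : u' - u ≤ 2 * Real.pi := by linarith
      have h6 : 0 ≤ u' - u := by linarith
      gcongr
    have h5 : 2 * Real.pi / u = t * (2 / Real.pi) := by rw [hu]; field_simp
    have h6 : 2 / Real.pi ≤ 1 := by rw [div_le_one hp]; linarith
    rw [h3]
    calc t * ((u' - u) / u') ≤ t * (t * (2 / Real.pi)) := by rw [← h5]; gcongr
      _ ≤ t * (t * 1) := by gcongr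
      _ = t ^ 2 := by ring
  · have : Real.pi ^ 2 / (Real.pi ^ 2 / u') = u' := by field_simp
    rw [this, hu', Real.sin_add_int_mul_two_pi]

/-- Membership in the unit ball is decided by the sign of the oscillation, and both extreme values
of its sine factor occur within t² of t. The chart is 2-Lipschitz. -/
theorem chartXTwo_mem_layer (hA : 0 < A) (hA1 : A < 1 / 1000) {t : ℝ} (ht : 0 < t)
    (htp : t ≤ Real.pi) : chartXTwo A t ∈ layer (chartXTwo A (-1)) 1 (2 * t ^ 2) := by
  have hp := Real.pi_pos
  have hmem : ∀ {t : ℝ}, 0 < t → t ≤ Real.pi →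
      (chartXTwo A t ∈ ball (chartXTwo A (-1)) 1 ↔ polyOsc A t < 0) := fun h0 hp => by
    rw [mem_ball, dist_chartXTwo_center hA hA1 ⟨h0.le, hp⟩]
    constructor <;> intro h <;> linarith
  have hdist : ∀ {t'}, 0 < t' → t' ≤ t → t - t' ≤ t ^ 2 →
      edist (chartXTwo A t) (chartXTwo A t') ≤ ENNReal.ofReal (2 * t ^ 2) := by
    intro t' h0 h1 h2
    rw [edist_dist]
    refine ENNReal.ofReal_le_ofReal
      ((dist_chartXTwo_le hA hA1 (by linarith) (by linarith)).trans ?_)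
    rw [abs_of_nonneg (by linarith)]
    linarith
  by_cases hb : chartXTwo A t ∈ ball (chartXTwo A (-1)) 1
  · obtain ⟨t', h0, h1, h2, h3⟩ := exists_near_sin_eq ht (Real.pi / 2)
    refine Or.inl ⟨hb, (infEDist_le_edist_of_mem ?_).trans (hdist h0 h1 h2)⟩
    rw [mem_compl_iff, hmem h0 (h1.trans htp), polyOsc, h3, Real.sin_pi_div_two]
    exact not_lt.2 (by positivity)
  · obtain ⟨t', h0, h1, h2, h3⟩ := exists_near_sin_eq ht (-(Real.pi / 2))
    refine Or.inr ⟨hb, (infEDist_le_edist_of_mem ?_).trans (hdist h0 h1 h2)⟩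
    rw [hmem h0 (h1.trans htp), polyOsc, h3, Real.sin_neg, Real.sin_pi_div_two]
    have : 0 < A * (t' / Real.pi) ^ 3 := by positivity
    linarith

theorem not_relativeLayerDecay_lengthXTwo (hA : 0 < A) (hA1 : A < 1 / 1000) :
    ¬ RelativeLayerDecay (lengthXTwo A) := by
  rintro ⟨η, hη, C, h⟩
  have hp3 := Real.pi_gt_three
  -- RLD with ε = R² would give R/40 ≤ C·q·800R, that is 1 ≤ 32000·C·q, which this q violates.
  set q : ℝ := 1 / (32000 * C + 1) with hq
  have hC : (0 : ℝ) ≤ C := C.coe_nonneg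
  have hq0 : 0 < q := by positivity
  have hq1 : q ≤ 1 := by rw [hq, div_le_one (by positivity)]; linarith
  set R : ℝ := q ^ (1 / η) with hR
  have hR0 : 0 < R := Real.rpow_pos_of_pos hq0 _
  have hR1 : R ≤ 1 := Real.rpow_le_one hq0.le hq1 (by positivity)
  have hRη : (R ^ 2 / R) ^ η = q := by
    rw [show R ^ 2 / R = R by field_simp, hR, ← Real.rpow_mul hq0.le, one_div_mul_cancel hη.ne',
      Real.rpow_one]
  have h1 := h (chartXTwo A (-1)) 1 one_pos (chartXTwo A 0) R hR0 (by linarith) (R ^ 2)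
    (by positivity)
  rw [hRη] at h1
  have hsub : chartXTwo A '' Ioo 0 (R / 2) ⊆
      layer (chartXTwo A (-1)) 1 (R ^ 2) ∩ ball (chartXTwo A 0) R := by
    rintro _ ⟨t, ht, rfl⟩
    constructor
    · have hle : ENNReal.ofReal (2 * t ^ 2) ≤ ENNReal.ofReal (R ^ 2) :=
        ENNReal.ofReal_le_ofReal (by nlinarith [ht.1, ht.2])
      rcases chartXTwo_mem_layer hA hA1 ht.1 (by linarith [ht.2]) with h | h
      · exact Or.inl ⟨h.1, h.2.trans hle⟩
      · exact Or.inr ⟨h.1, h.2.trans hle⟩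
    · rw [mem_ball]
      refine (dist_chartXTwo_le hA hA1 (by linarith [ht.1]) (by norm_num)).trans_lt ?_
      rw [sub_zero, abs_of_pos ht.1]
      linarith [ht.2]
  have h2 : ENNReal.ofReal (R / 40) ≤ lengthXTwo A (chartXTwo A '' Ioo 0 (R / 2)) := by
    refine ofReal_length_le_measure_image hA hA1
      (fun t ht => mem_Ici.2 (by linarith [ht.1])) ?_
    rw [Real.volume_Ioo]
    exact ENNReal.ofReal_le_ofReal (by linarith)
  have h3 := (h2.trans (measure_mono hsub)).trans h1
  have h4 := h3.trans (mul_le_mul_right (lengthXTwo_ball_le hA hA1 (chartXTwo A 0) R) _)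
  rw [← ENNReal.ofReal_coe_nnreal, ← ENNReal.ofReal_mul hC,
    ← ENNReal.ofReal_mul (by positivity), ENNReal.ofReal_le_ofReal_iff (by positivity)] at h4
  have h5 : q * (32000 * C + 1) = 1 := by rw [hq]; field_simp
  have h6 : R * (1 - 32000 * (C * q)) ≤ 0 := by linarith
  have h7 : 0 < R * (1 - 32000 * (C * q)) := mul_pos hR0 (by linarith)
  linarith

/-! ### Failure of the Hardy inequality -/

/-- The `m`-th interval between consecutive zeros of `polyOsc`. -/
def oscInterval (m : ℕ) : Set ℝ := Ioo (Real.pi / (m + 1)) (Real.pi / m)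

theorem oscInterval_subset_Ioo {m : ℕ} (hm : 1 ≤ m) : oscInterval m ⊆ Ioo 0 Real.pi := by
  have hp := Real.pi_pos
  intro t ht
  refine ⟨lt_trans (by positivity) ht.1, ht.2.trans_le (div_le_self hp.le (by exact_mod_cast hm))⟩

theorem oscInterval_subset_Ici {m : ℕ} (hm : 1 ≤ m) : oscInterval m ⊆ Ici (-1) := fun _ ht =>
  mem_Ici.2 (by linarith [(oscInterval_subset_Ioo hm ht).1])

theorem volume_oscInterval {m : ℕ} (hm : 1 ≤ m) :
    volume (oscInterval m) = ENNReal.ofReal (Real.pi / (m * (m + 1))) := by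
  rw [oscInterval, Real.volume_Ioo]
  congr 1
  have : (m : ℝ) ≠ 0 := by positivity
  field_simp
  ring

theorem disjoint_oscInterval {m n : ℕ} (hmn : m ≠ n) :
    Disjoint (oscInterval m) (oscInterval n) := by
  wlog h : m < n generalizing m n
  · exact (this hmn.symm (by omega)).symm
  rw [Set.disjoint_left]
  rintro t ht ht'
  have hp := Real.pi_pos
  have h1 : Real.pi / n ≤ Real.pi / (m + 1) := by
    gcongr; exact_mod_cast h
  linarith [ht.1, ht'.2]

theorem disjoint_image_oscInterval (hA : 0 < A) (hA1 : A < 1 / 1000) {m n : ℕ} (hm : 1 ≤ m)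
    (hn : 1 ≤ n) (hmn : m ≠ n) :
    Disjoint (chartXTwo A '' oscInterval m) (chartXTwo A '' oscInterval n) := by
  rw [Set.disjoint_left]
  rintro _ ⟨t, ht, rfl⟩ ⟨s, hs, hst⟩
  have h1 := (isChordArcChart_chartXTwo hA hA1).abs_sub_le s t (oscInterval_subset_Ici hn hs)
    (oscInterval_subset_Ici hm ht)
  rw [hst, dist_self, mul_zero] at h1
  have h2 : s = t := sub_eq_zero.1 (abs_nonpos_iff.1 h1)
  exact Set.disjoint_left.1 (disjoint_oscInterval hmn) ht (h2 ▸ hs)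

theorem sin_oscInterval {m : ℕ} (hm : 1 ≤ m) {t : ℝ} (ht : t ∈ oscInterval m) :
    0 < (-1 : ℝ) ^ m * Real.sin (Real.pi ^ 2 / t) := by
  have hp := Real.pi_pos
  have ht0 := (oscInterval_subset_Ioo hm ht).1
  have h1 : m * Real.pi < Real.pi ^ 2 / t := by
    have := ht.2
    rw [lt_div_iff₀ (by positivity)] at this ⊢
    nlinarith
  have h2 : Real.pi ^ 2 / t < (m + 1) * Real.pi := by
    have := ht.1
    rw [div_lt_iff₀ (by positivity)] at this ⊢
    nlinarith
  have h3 := Real.sin_add_nat_mul_pi (Real.pi ^ 2 / t - m * Real.pi) m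
  rw [sub_add_cancel] at h3
  rw [h3, ← mul_assoc, ← mul_pow]
  norm_num
  exact Real.sin_pos_of_pos_of_lt_pi (by linarith) (by linarith)

theorem image_oscInterval_even_subset (hA : 0 < A) (hA1 : A < 1 / 1000) {j : ℕ} (hj : 1 ≤ j) :
    chartXTwo A '' oscInterval (2 * j) ⊆
      ball (chartXTwo A (-1)) (2 * 1) \ ball (chartXTwo A (-1)) 1 := by
  rintro _ ⟨t, ht, rfl⟩
  have ht' := oscInterval_subset_Ioo (by omega) ht
  have h1 := sin_oscInterval (by omega) ht
  rw [pow_mul] at h1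
  norm_num at h1
  have hp := Real.pi_pos
  have h2 : 0 ≤ polyOsc A t := by
    have := ht'.1
    rw [polyOsc]; positivity
  have h3 := abs_le.1 (abs_polyOsc_le_amplitude hA.le ht'.1.le ht'.2.le)
  rw [mem_sdiff, mem_ball, mem_ball, dist_chartXTwo_center hA hA1 ⟨ht'.1.le, ht'.2.le⟩]
  constructor <;> linarith

theorem image_oscInterval_odd_subset (hA : 0 < A) (hA1 : A < 1 / 1000) (k : ℕ) :
    chartXTwo A '' oscInterval (2 * k + 1) ⊆ ball (chartXTwo A (-1)) 1 := by
  rintro _ ⟨t, ht, rfl⟩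
  have ht' := oscInterval_subset_Ioo (by omega) ht
  have h1 := sin_oscInterval (by omega) ht
  rw [pow_succ, pow_mul] at h1
  norm_num at h1
  have hp := Real.pi_pos
  have h2 : polyOsc A t < 0 := by
    have := ht'.1
    rw [polyOsc]
    exact mul_neg_of_pos_of_neg (by positivity) h1
  rw [mem_ball, dist_chartXTwo_center hA hA1 ⟨ht'.1.le, ht'.2.le⟩]
  linarith

/-- Both parameters lie in an interval of length at most 2(i+1)/n². The chart is 2-Lipschitz and
balls have measure at most 800 times their radius. -/
theorem lam_le_of_mem_oscInterval (hA : 0 < A) (hA1 : A < 1 / 1000) {n k i : ℕ} (hn : 1 ≤ n)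
    (hk : n ≤ k) {s t : ℝ} (hs : s ∈ oscInterval (2 * (k + i)))
    (ht : t ∈ oscInterval (2 * k + 1)) :
    lam (lengthXTwo A) (chartXTwo A s) (chartXTwo A t) ≤
      ENNReal.ofReal (3200 * (i + 1) / n ^ 2) := by
  have hp := Real.pi_pos
  have hp4 := Real.pi_lt_four
  have hn' : (1 : ℝ) ≤ n := by exact_mod_cast hn
  have hk' : (n : ℝ) ≤ k := by exact_mod_cast hk
  have hi : (0 : ℝ) ≤ i := Nat.cast_nonneg i
  have hk0 : (0 : ℝ) < k := by linarith
  have e1 : s < Real.pi / (2 * k) := hs.2.trans_le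
    (div_le_div_of_nonneg_left hp.le (by linarith) (by push_cast; linarith))
  have e2 : t < Real.pi / (2 * k) := ht.2.trans_le
    (div_le_div_of_nonneg_left hp.le (by linarith) (by push_cast; linarith))
  have e3 : Real.pi / (2 * k + 2 * i + 2) < s := lt_of_le_of_lt
    (div_le_div_of_nonneg_left hp.le (by positivity) (by push_cast; linarith)) hs.1
  have e4 : Real.pi / (2 * k + 2 * i + 2) < t := lt_of_le_of_lt
    (div_le_div_of_nonneg_left hp.le (by positivity) (by push_cast; linarith)) ht.1
  have e5 : Real.pi / (2 * k) - Real.pi / (2 * k + 2 * i + 2) ≤ 2 * (i + 1) / n ^ 2 := by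
    calc Real.pi / (2 * k) - Real.pi / (2 * k + 2 * i + 2)
        = Real.pi * (i + 1) / (k * (2 * k + 2 * i + 2)) := by field_simp; ring
      _ ≤ 4 * (i + 1) / (n * (2 * n)) := by gcongr; linarith
      _ = 2 * (i + 1) / n ^ 2 := by field_simp; norm_num
  have e6 : |s - t| ≤ 2 * (i + 1) / n ^ 2 := by
    rw [abs_le]; constructor <;> linarith
  refine (lengthXTwo_ball_le hA hA1 _ _).trans (ENNReal.ofReal_le_ofReal ?_)
  have e7 := dist_chartXTwo_le hA hA1 (oscInterval_subset_Ici (by omega) hs)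
    (oscInterval_subset_Ici (by omega) ht)
  calc 800 * dist (chartXTwo A s) (chartXTwo A t) ≤ 800 * (2 * (2 * (i + 1) / n ^ 2)) := by
        gcongr; exact e7.trans (by gcongr)
    _ = _ := by ring

theorem measurableSet_image_oscInterval (hA : 0 < A) (hA1 : A < 1 / 1000) {m : ℕ} (hm : 1 ≤ m) :
    MeasurableSet (chartXTwo A '' oscInterval m) :=
  (isChordArcChart_chartXTwo hA hA1).measurableSet_image (oscInterval_subset_Ici hm)
    measurableSet_Ioo

theorem ofReal_le_measure_image_oscInterval (hA : 0 < A) (hA1 : A < 1 / 1000) {m n : ℕ}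
    (hm : 1 ≤ m) (hmn : m < n) :
    ENNReal.ofReal (3 / (20 * n ^ 2)) ≤ lengthXTwo A (chartXTwo A '' oscInterval m) := by
  have hp3 := Real.pi_gt_three
  have hm' : (1 : ℝ) ≤ m := by exact_mod_cast hm
  have hmn' : (m : ℝ) + 1 ≤ n := by exact_mod_cast hmn
  refine ofReal_length_le_measure_image hA hA1 (oscInterval_subset_Ici hm) ?_
  rw [volume_oscInterval hm]
  refine ENNReal.ofReal_le_ofReal ?_
  calc 20 * (3 / (20 * (n : ℝ) ^ 2)) = 3 / (n * n) := by field_simp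
    _ ≤ Real.pi / (m * (m + 1)) := by gcongr

theorem not_hardyInequality_two_lengthXTwo (hA : 0 < A) (hA1 : A < 1 / 1000) :
    ¬ HardyInequality (lengthXTwo A) 2 := by
  rintro ⟨C, h⟩
  have hp := Real.pi_pos
  have hp4 := Real.pi_lt_four
  set μ := lengthXTwo A with hμ
  have key : ∀ n : ℕ, 1 ≤ n →
      ENNReal.ofReal (∑ i ∈ Finset.range n, 1 / ((i : ℝ) + 1)) ≤
        ENNReal.ofReal (800000 * (C * 12000)) := by
    intro n hn
    have hn' : (1 : ℝ) ≤ n := by exact_mod_cast hn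
    -- `F` collects arcs inside the ball and `G` arcs outside it. The index range of `G` is longer
    -- so that k + i stays in it for all k in the range of `F` and all i < n.
    set F : Set (XTwo A) :=
      ⋃ k ∈ Finset.Ico n (2 * n), chartXTwo A '' oscInterval (2 * k + 1) with hF
    set G : Set (XTwo A) :=
      ⋃ j ∈ Finset.Ico n (3 * n), chartXTwo A '' oscInterval (2 * j) with hG
    have hFm : MeasurableSet F := Finset.measurableSet_biUnion _ fun k _ =>
      measurableSet_image_oscInterval hA hA1 (by omega)
    have hGm : MeasurableSet G := Finset.measurableSet_biUnion _ fun j hj =>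
      measurableSet_image_oscInterval hA hA1 (by have := (Finset.mem_Ico.1 hj).1; omega)
    have hFsub : F ⊆ ball (chartXTwo A (-1)) 1 :=
      iUnion₂_subset fun k _ => image_oscInterval_odd_subset hA hA1 k
    have hGsub : G ⊆ ball (chartXTwo A (-1)) (2 * 1) \ ball (chartXTwo A (-1)) 1 :=
      iUnion₂_subset fun j hj =>
        image_oscInterval_even_subset hA hA1 (hn.trans (Finset.mem_Ico.1 hj).1)
    have hFlow : ENNReal.ofReal (3 / (320 * n)) ≤ μ F := by
      rw [hF, measure_biUnion_finset
        (fun k _ l _ hkl => disjoint_image_oscInterval hA hA1 (by omega) (by omega) (by omega))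
        (fun k _ => measurableSet_image_oscInterval hA hA1 (by omega))]
      calc ENNReal.ofReal (3 / (320 * n))
          = ∑ k ∈ Finset.Ico n (2 * n), ENNReal.ofReal (3 / (20 * ((4 * n : ℕ) : ℝ) ^ 2)) := by
            rw [Finset.sum_const, Nat.card_Ico, nsmul_eq_mul, show 2 * n - n = n by omega,
              ← ENNReal.ofReal_natCast, ← ENNReal.ofReal_mul (by positivity)]
            congr 1
            push_cast
            field_simp
            norm_num
        _ ≤ _ := Finset.sum_le_sum fun k hk => ofReal_le_measure_image_oscInterval hA hA1
            (by omega) (by have := (Finset.mem_Ico.1 hk).2; omega)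
    have hGup : μ G ≤ ENNReal.ofReal (40 / n) := by
      have hsub : G ⊆ chartXTwo A '' Ioo 0 (Real.pi / (2 * n)) := by
        refine iUnion₂_subset fun j hj => image_mono fun t ht => ?_
        have hj' : (n : ℝ) ≤ j := by exact_mod_cast (Finset.mem_Ico.1 hj).1
        refine ⟨(oscInterval_subset_Ioo (by have := (Finset.mem_Ico.1 hj).1; omega) ht).1,
          ht.2.trans_le ?_⟩
        push_cast
        gcongr
      refine (measure_mono hsub).trans (((isChordArcChart_chartXTwo hA hA1).measure_image_le
        (fun t ht => mem_Ici.2 (by linarith [ht.1]))).trans ?_)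
      rw [Real.volume_Ioo, ← ENNReal.ofReal_coe_nnreal, ← ENNReal.ofReal_mul (by positivity)]
      refine ENNReal.ofReal_le_ofReal ?_
      push_cast
      calc 20 * (Real.pi / (2 * n) - 0) ≤ 20 * (4 / (2 * n)) := by rw [sub_zero]; gcongr
        _ = 40 / n := by field_simp; norm_num
    have hFpos : μ F ≠ 0 := fun h0 => by
      rw [h0, nonpos_iff_eq_zero, ENNReal.ofReal_eq_zero] at hFlow
      exact absurd hFlow (not_le.2 (by positivity))
    have hFtop : μ F ≠ ∞ := ((measure_mono hFsub).trans_lt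
      ((lengthXTwo_ball_le hA hA1 _ _).trans_lt ENNReal.ofReal_lt_top)).ne
    have hGF : μ G ≤ ENNReal.ofReal 12000 * μ F := by
      calc μ G ≤ ENNReal.ofReal (40 / n) := hGup
        _ ≤ ENNReal.ofReal (12000 * (3 / (320 * n))) := by
          refine ENNReal.ofReal_le_ofReal ?_
          rw [mul_div_assoc', div_le_div_iff₀ (by positivity) (by positivity)]
          nlinarith
        _ = ENNReal.ofReal 12000 * ENNReal.ofReal (3 / (320 * n)) :=
          ENNReal.ofReal_mul (by norm_num)
        _ ≤ _ := by gcongr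
    have hGtop : μ G ≠ ∞ := (hGup.trans_lt ENNReal.ofReal_lt_top).ne
    have hh := h (chartXTwo A (-1)) 1 one_pos (F.indicator fun _ => 1) (G.indicator fun _ => 1)
      (memLp_indicator_const _ hFm _ (Or.inr hFtop))
      (Function.support_subset_iff'.2 fun y hy => indicator_of_notMem (fun hF => hy (hFsub hF)) _)
      (memLp_indicator_const _ hGm _ (Or.inr hGtop))
      (Function.support_subset_iff'.2 fun y hy => indicator_of_notMem (fun hG => hy (hGsub hG)) _)
    have hrhs : C * eLpNorm (F.indicator fun _ => (1 : ℂ)) (ENNReal.ofReal 2) μ *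
        eLpNorm (G.indicator fun _ => (1 : ℂ)) (ENNReal.ofReal (2 / (2 - 1))) μ ≤
        C * ENNReal.ofReal 12000 * μ F := by
      have h2 : ENNReal.ofReal 2 = 2 := by norm_num
      rw [show (2 : ℝ) / (2 - 1) = 2 by norm_num, h2,
        eLpNorm_indicator_const hFm two_ne_zero ENNReal.ofNat_ne_top,
        eLpNorm_indicator_const hGm two_ne_zero ENNReal.ofNat_ne_top]
      simp only [enorm_one, one_mul, ENNReal.toReal_ofNat]
      rw [mul_assoc, mul_assoc]
      refine mul_le_mul_right ?_ _
      calc μ F ^ (1 / 2 : ℝ) * μ G ^ (1 / 2 : ℝ)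
          ≤ μ F ^ (1 / 2 : ℝ) * (ENNReal.ofReal 12000 * μ F) ^ (1 / 2 : ℝ) := by gcongr
        _ = ENNReal.ofReal 12000 ^ (1 / 2 : ℝ) * (μ F ^ (1 / 2 : ℝ) * μ F ^ (1 / 2 : ℝ)) := by
          rw [ENNReal.mul_rpow_of_nonneg _ _ (by norm_num)]; ring
        _ = ENNReal.ofReal 12000 ^ (1 / 2 : ℝ) * μ F := by
          rw [← ENNReal.rpow_add _ _ hFpos hFtop]; norm_num
        _ ≤ ENNReal.ofReal 12000 ^ (1 : ℝ) * μ F := by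
          gcongr
          · norm_num
          · norm_num
        _ = _ := by rw [ENNReal.rpow_one]
    have hlhs : ENNReal.ofReal (∑ i ∈ Finset.range n, 1 / (800000 * ((i : ℝ) + 1))) * μ F ≤
        ∫⁻ y in ball (chartXTwo A (-1)) 1,
          ∫⁻ x in ball (chartXTwo A (-1)) (2 * 1) \ ball (chartXTwo A (-1)) 1,
            ‖F.indicator (fun _ => (1 : ℂ)) y‖ₑ * ‖G.indicator (fun _ => (1 : ℂ)) x‖ₑ / lam μ x y
            ∂μ ∂μ := by
      refine le_trans ?_ (lintegral_mono_set hFsub)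
      rw [← setLIntegral_const]
      refine setLIntegral_mono' hFm fun y hy => ?_
      rw [indicator_of_mem hy]
      obtain ⟨k, hk, t, ht, rfl⟩ := mem_iUnion₂.1 hy
      rw [Finset.mem_Ico] at hk
      -- For y in arc k it suffices to integrate over the outer arcs k + i with i < n, each
      -- contributing at least a multiple of 1/(i+1).
      have hsub : (⋃ i ∈ Finset.range n, chartXTwo A '' oscInterval (2 * (k + i))) ⊆ G := by
        refine iUnion₂_subset fun i hi => ?_
        rw [Finset.mem_range] at hi
        exact subset_biUnion_of_mem (u := fun j => chartXTwo A '' oscInterval (2 * j))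
          (show k + i ∈ (Finset.Ico n (3 * n) : Set ℕ) by
            rw [Finset.mem_coe, Finset.mem_Ico]; omega)
      refine le_trans ?_ (lintegral_mono_set (hsub.trans hGsub))
      rw [lintegral_biUnion_finset
        (fun i _ l _ hil => disjoint_image_oscInterval hA hA1 (by omega) (by omega) (by omega))
        (fun i _ => measurableSet_image_oscInterval hA hA1 (by omega)),
        ENNReal.ofReal_sum_of_nonneg (fun i _ => by positivity)]
      refine Finset.sum_le_sum fun i hi => ?_
      have hin := Finset.mem_range.1 hi
      calc ENNReal.ofReal (1 / (800000 * ((i : ℝ) + 1)))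
          ≤ ENNReal.ofReal ((3200 * ((i : ℝ) + 1) / (n : ℝ) ^ 2)⁻¹ *
              (3 / (20 * ((6 * n : ℕ) : ℝ) ^ 2))) := by
            refine ENNReal.ofReal_le_ofReal ?_
            push_cast
            rw [show (3200 * ((i : ℝ) + 1) / (n : ℝ) ^ 2)⁻¹ * (3 / (20 * (6 * (n : ℝ)) ^ 2)) =
              1 / (768000 * ((i : ℝ) + 1)) by field_simp; norm_num]
            gcongr
            norm_num
        _ = (ENNReal.ofReal (3200 * ((i : ℝ) + 1) / (n : ℝ) ^ 2))⁻¹ *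
              ENNReal.ofReal (3 / (20 * ((6 * n : ℕ) : ℝ) ^ 2)) := by
            rw [ENNReal.ofReal_mul (by positivity), ENNReal.ofReal_inv_of_pos (by positivity)]
        _ ≤ (ENNReal.ofReal (3200 * ((i : ℝ) + 1) / (n : ℝ) ^ 2))⁻¹ *
              μ (chartXTwo A '' oscInterval (2 * (k + i))) := by
            gcongr
            exact ofReal_le_measure_image_oscInterval hA hA1 (by omega) (by omega)
        _ ≤ _ := by
            rw [← setLIntegral_const]
            refine setLIntegral_mono'
              (measurableSet_image_oscInterval hA hA1 (by omega)) fun x hx => ?_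
            have hxG : x ∈ G := hsub (mem_iUnion₂.2 ⟨i, hi, hx⟩)
            rw [indicator_of_mem hxG]
            obtain ⟨s, hs, rfl⟩ := hx
            simp only [enorm_one, one_mul, one_div]
            exact ENNReal.inv_le_inv.2 (lam_le_of_mem_oscInterval hA hA1 hn hk.1 hs ht)
    -- Both sides are proportional to the measure of `F`; cancelling it leaves harmonic sums bounded
    -- independently of n.
    have hfin := (ENNReal.mul_le_mul_iff_left hFpos hFtop).1 ((hlhs.trans hh).trans hrhs)
    calc ENNReal.ofReal (∑ i ∈ Finset.range n, 1 / ((i : ℝ) + 1))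
        = ENNReal.ofReal 800000 *
            ENNReal.ofReal (∑ i ∈ Finset.range n, 1 / (800000 * ((i : ℝ) + 1))) := by
          rw [← ENNReal.ofReal_mul (by norm_num), Finset.mul_sum]
          congr 1
          refine Finset.sum_congr rfl fun i _ => ?_
          field_simp
      _ ≤ ENNReal.ofReal 800000 * (C * ENNReal.ofReal 12000) := by gcongr
      _ = _ := by
          rw [ENNReal.ofReal_mul (by norm_num), ENNReal.ofReal_mul C.coe_nonneg,
            ENNReal.ofReal_coe_nnreal]
  obtain ⟨n, hn1, hn⟩ := ((Filter.eventually_ge_atTop 1).and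
    (Real.tendsto_sum_range_one_div_nat_succ_atTop.eventually_gt_atTop
      (800000 * (C * 12000)))).exists
  have h1 := key n hn1
  rw [ENNReal.ofReal_le_ofReal_iff (by positivity)] at h1
  exact absurd hn (not_lt.2 h1)

end Failure

/-! ### The main theorem -/

theorem mainTheorem6 :
    ∃ A₁ : ℝ, 0 < A₁ ∧ ∀ A₀ : ℝ, 0 < A₀ → A₀ < A₁ →
      IsHomogeneousType (lengthXTwo A₀) ∧
      ¬ HardyInequality (lengthXTwo A₀) 2 ∧
      ¬ HardyProperty (lengthXTwo A₀) ∧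
      ¬ RelativeLayerDecay (lengthXTwo A₀) ∧
      LayerDecayWith (lengthXTwo A₀) (1 / 2) := by
  refine ⟨1 / 1000, by norm_num, fun A₀ hA hA1 => ?_⟩
  have hHardy := not_hardyInequality_two_lengthXTwo hA hA1
  exact ⟨(isChordArcChart_chartXTwo hA hA1).isHomogeneousType, hHardy,
    fun h => hHardy (h 2 one_lt_two), not_relativeLayerDecay_lengthXTwo hA hA1,
    layerDecayWith_lengthXTwo hA hA1⟩
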